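/- Let $A\in\mathbb R^{n\times n}$, $C\in\mathbb R^{p\times n}$, $D\in\mathbb R^{p\times m}$, let $Q\in\mathbb R^{n\times n}$ be symmetric positive semidefinite and $R\in\mathbb R^{p\times p}$ symmetric positive definite, and assume that $(A,Q^{1/2})$ is stabilizable and $(A,C)$ is detectable. Consider on $[0,\infty)$ the system $\dot x_t=Ax_t$, $y_t=Cx_t+Dd_t$, where the disturbance (outlier) $d_t\in\mathbb R^m$ satisfies $\|d_t\|\le\mu$ for all $t\ge0$, with $0<\mu<\infty$, and the innovation-saturated Kalman filter $$\dot{\hat x}_t=A\hat x_t+K_t\,\mathrm{sat}_\sigma(y_t-C\hat x_t),\qquad K_t=P_tC^\top R^{-1},\qquad \dot P_t=AP_t+P_tA^\top+Q-K_tRK_t^\top,$$ where $P_0$ is positive definite, the $i$-th entry of $\mathrm{sat}_\sigma(r)$ is $\max\{-\sqrt{\sigma_i},\min\{\sqrt{\sigma_i},r_i\}\}$, and for $i=1,\dots,p$ $$\dot\sigma_{i,t}=\lambda_{1,i}\sigma_{i,t}+\gamma_{1,i}\varepsilon_{i,t}e^{-\varepsilon_{i,t}},\quad \sigma_{i,0}>0,\qquad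 \dot\varepsilon_{i,t}=\lambda_{2,i}\varepsilon_{i,t}+\gamma_{2,i}(y_{i,t}-(C\hat x_t)_i)^2,\quad \varepsilon_{i,0}>0,$$ with $\lambda_{1,i},\lambda_{2,i}<0$ and $\gamma_{1,i},\gamma_{2,i}>0$. (Since $d$ may jump, the equations for $\hat x,\sigma,\varepsilon$ are understood for almost every $t$, with locally absolutely continuous solutions.) Put $e_t=\hat x_t-x_t$, $\Gamma_2=\mathrm{diag}(\gamma_{2,1},\dots,\gamma_{2,p})$ and $V_0=e_0^\top P_0^{-1}e_0+\sum_i\sigma_{i,0}+\sum_i\varepsilon_{i,0}$. Suppose that there are a diagonal positive definite $W$, a positive definite $U$ and a number $\alpha$ with $$0<\alpha\le-\max_{1\le i\le p}\max\{\lambda_{1,i},\ \lambda_{2,i}+\gamma_{1,i}\}$$ such that for all $t\ge0$ the symmetric matrix $$S_t=\begin{bmatrix}P_t^{-1}QP_t^{-1}+C^\top(R^{-1}-\Gamma_2)C-\alpha P_t^{-1}&-C^\top(R^{-1}+W)&C^\top(\Gamma_2-R^{-1})D\\ \star&2W&WD\\ \star&\star&U\end{bmatrix}$$ is positive semidefinite.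 Let $c_1$ be the largest eigenvalue of $U+D^\top\Gamma_2D$. Then: 1. For every $t\ge0$, with $c_2=c_2(t)$ the smallest eigenvalue of $P_t^{-1}$, $$\|e_t\|\le\sqrt{\frac1{c_2}\Big[e^{-\alpha t}V_0+\frac1\alpha(1-e^{-\alpha t})c_1\mu^2\Big]}.$$ 2. As $t\to\infty$, $P_t$ converges to a positive definite matrix $P_\infty$, which is the unique positive definite solution of $AP_\infty+P_\infty A^\top+Q-P_\infty C^\top R^{-1}CP_\infty=0$, and, with $c_3$ the smallest eigenvalue of $P_\infty^{-1}$, $$\limsup_{t\to\infty}\|e_t\|\le\sqrt{\frac{c_1}{\alpha c_3}}\;\mu<\infty .$$ 3. If $d_t\to0$ as $t\to\infty$, then $e_t\to0$; and if $d_t=0$ for all sufficiently large $t$, then $\|e_t\|\le\kappa e^{-\alpha t/2}$ for all $t\ge0$ and some constant $\kappa$. -/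

import Mathlib

open Matrix Filter Topology MeasureTheory Set

noncomputable section

namespace ISKF

/-- The saturation function `sat_ε(r) = max{-ε, min{ε, r}}`. -/
def sat (ε r : ℝ) : ℝ := max (-ε) (min ε r)

/-- The smallest (real) eigenvalue; used for symmetric matrices only. -/
def lamMin {k : ℕ} (M : Matrix (Fin k) (Fin k) ℝ) : ℝ := sInf (spectrum ℝ M)

/-- The largest (real) eigenvalue; used for symmetric matrices only. -/
def lamMax {k : ℕ} (M : Matrix (Fin k) (Fin k) ℝ) : ℝ := sSup (spectrum ℝ M)

/-- All complex eigenvalues of the real matrix `M` have negative real part. -/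
def IsHurwitz {k : ℕ} (M : Matrix (Fin k) (Fin k) ℝ) : Prop :=
  ∀ z ∈ spectrum ℂ (M.map (algebraMap ℝ ℂ)), z.re < 0

/-- `(A, B)` is stabilizable: some state feedback makes `A + B F` Hurwitz. -/
def Stabilizable {n q : ℕ} (A : Matrix (Fin n) (Fin n) ℝ) (B : Matrix (Fin n) (Fin q) ℝ) : Prop :=
  ∃ F : Matrix (Fin q) (Fin n) ℝ, IsHurwitz (A + B * F)

/-- `(A, C)` is detectable: some output injection makes `A + L C` Hurwitz. -/
def Detectable {n p : ℕ} (A : Matrix (Fin n) (Fin n) ℝ) (C : Matrix (Fin p) (Fin n) ℝ) : Prop :=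
  ∃ L : Matrix (Fin n) (Fin p) ℝ, IsHurwitz (A + L * C)

/-- The right-hand side `A P + P Aᵀ + Q - K R Kᵀ`, with `K = P Cᵀ R⁻¹`, of the covariance equation. -/
def riccati {n p : ℕ} (A : Matrix (Fin n) (Fin n) ℝ) (C : Matrix (Fin p) (Fin n) ℝ)
    (Q : Matrix (Fin n) (Fin n) ℝ) (R : Matrix (Fin p) (Fin p) ℝ)
    (P : Matrix (Fin n) (Fin n) ℝ) : Matrix (Fin n) (Fin n) ℝ :=
  A * P + P * Aᵀ + Q - (P * Cᵀ * R⁻¹) * R * (P * Cᵀ * R⁻¹)ᵀ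

/-- `P` is a solution of the Riccati differential equation on `[0, ∞)`, entry by entry. -/
def IsRiccatiSolution {n p : ℕ} (A : Matrix (Fin n) (Fin n) ℝ) (C : Matrix (Fin p) (Fin n) ℝ)
    (Q : Matrix (Fin n) (Fin n) ℝ) (R : Matrix (Fin p) (Fin p) ℝ)
    (P : ℝ → Matrix (Fin n) (Fin n) ℝ) : Prop :=
  ∀ t, 0 ≤ t → ∀ i j,
    HasDerivWithinAt (fun s => P s i j) (riccati A C Q R (P t) i j) (Ici 0) t

/-- `u` solves `u' = g` on `[0, ∞)` in the sense of Carathéodory: `u` is locally absolutely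
continuous and the equation holds for almost every `t ≥ 0`. (The disturbance, and so the right-hand
sides in which it enters, may jump.) -/
def SolvesAE (u g : ℝ → ℝ) : Prop :=
  (∀ T, 0 ≤ T → AbsolutelyContinuousOnInterval u 0 T) ∧
    ∀ᵐ t ∂(volume : Measure ℝ), 0 ≤ t → HasDerivAt u (g t) t

/-- The innovation `y_t - C x̂_t`, where `y_t = C x_t + D d_t`. -/
def innovation {n p m : ℕ} (C : Matrix (Fin p) (Fin n) ℝ) (D : Matrix (Fin p) (Fin m) ℝ)
    (d : ℝ → EuclideanSpace ℝ (Fin m)) (x xhat : ℝ → EuclideanSpace ℝ (Fin n)) (t : ℝ) :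
    Fin p → ℝ :=
  (C *ᵥ (x t).ofLp + D *ᵥ (d t).ofLp) - C *ᵥ (xhat t).ofLp

/-- `x` is a trajectory of the plant `x' = A x`; `xhat`, `σ`, `ε` are the state estimate, the squared
saturation bounds and the innovation trackers produced by the innovation-saturated filter, with
gain `K_t = P_t Cᵀ R⁻¹`, from the output `y = C x + D d`. -/
structure IsTrajectory {n p m : ℕ} (A : Matrix (Fin n) (Fin n) ℝ) (C : Matrix (Fin p) (Fin n) ℝ)
    (D : Matrix (Fin p) (Fin m) ℝ) (R : Matrix (Fin p) (Fin p) ℝ)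
    (lam1 lam2 gam1 gam2 : Fin p → ℝ) (d : ℝ → EuclideanSpace ℝ (Fin m))
    (P : ℝ → Matrix (Fin n) (Fin n) ℝ) (x xhat : ℝ → EuclideanSpace ℝ (Fin n))
    (σ ε : ℝ → Fin p → ℝ) : Prop where
  plant : ∀ t, 0 ≤ t → ∀ i,
    HasDerivWithinAt (fun s => x s i) ((A *ᵥ (x t).ofLp) i) (Ici 0) t
  estimate : ∀ i, SolvesAE (fun t => xhat t i) (fun t =>
    (A *ᵥ (xhat t).ofLp + (P t * Cᵀ * R⁻¹) *ᵥ
      (fun j => sat (Real.sqrt (σ t j)) (innovation C D d x xhat t j))) i)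
  bound : ∀ i, SolvesAE (fun t => σ t i) (fun t =>
    lam1 i * σ t i + gam1 i * (ε t i * Real.exp (-(ε t i))))
  tracker : ∀ i, SolvesAE (fun t => ε t i) (fun t =>
    lam2 i * ε t i + gam2 i * (innovation C D d x xhat t i) ^ 2)
  bound_pos : ∀ i, 0 < σ 0 i
  tracker_pos : ∀ i, 0 < ε 0 i

/-- The symmetric block matrix `S_t`, for `P = P_t`, `Γ₂ = diag gam2` and `W = diag w`. -/
def blockS {n p m : ℕ} (C : Matrix (Fin p) (Fin n) ℝ) (D : Matrix (Fin p) (Fin m) ℝ)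
    (Q : Matrix (Fin n) (Fin n) ℝ) (R : Matrix (Fin p) (Fin p) ℝ) (gam2 w : Fin p → ℝ)
    (U : Matrix (Fin m) (Fin m) ℝ) (α : ℝ) (P : Matrix (Fin n) (Fin n) ℝ) :
    Matrix (Fin n ⊕ (Fin p ⊕ Fin m)) (Fin n ⊕ (Fin p ⊕ Fin m)) ℝ :=
  let M := P⁻¹ * Q * P⁻¹ + Cᵀ * (R⁻¹ - diagonal gam2) * C
  let S₁₂ := -(Cᵀ * (R⁻¹ + diagonal w))
  let S₁₃ := Cᵀ * (diagonal gam2 - R⁻¹) * D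
  let S₂₃ := diagonal w * D
  fromBlocks (M - α • P⁻¹) (fromCols S₁₂ S₁₃) (fromCols S₁₂ S₁₃)ᵀ
    (fromBlocks ((2 : ℝ) • diagonal w) S₂₃ S₂₃ᵀ U)

/-- The function `V = eᵀ P⁻¹ e + ∑ σ_i + ∑ ε_i`. -/
def lyapunov {n p : ℕ} (P : Matrix (Fin n) (Fin n) ℝ) (e : EuclideanSpace ℝ (Fin n))
    (σ ε : Fin p → ℝ) : ℝ :=
  e.ofLp ⬝ᵥ (P⁻¹ *ᵥ e.ofLp) + ∑ i, σ i + ∑ i, ε i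

end ISKF

end

/-! The error is controlled by `V = eᵀ P⁻¹ e + ∑ σ_i + ∑ ε_i`. With `r` the innovation, `s` its
saturation and `ψ = s - r`, we have `e' = A e + K s`, and saturation satisfies the sector condition
`ψ_i s_i ≤ 0`. Adding this condition with the weights `W` (an S-procedure) and using `ε exp (-ε) ≤
ε`, nonnegativity of the form of `S_t` at `(e, ψ, d)` becomes `V' ≤ -α V + c₁ ‖d‖²` almost
everywhere (`lyapunov_deriv_le`). Grönwall's inequality for absolutely continuous functions
(`le_of_ae_dissipation`), started at any time `T`, gives the bound at every time and both claims
about vanishing disturbances.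

The limit of `P` comes from the first diagonal block of `S_t`. Put `H = Cᵀ R⁻¹ C`. Testing the block
on `P v` gives `Q + P H P ≥ α P` (`dominates_of_blockS`). For the velocity `Y = P'`, the weighted
norm `g = tr (P⁻¹ Y P⁻¹ Y)` satisfies `g' = -2 tr ((P⁻¹ Q P⁻¹ + H) Y P⁻¹ Y) ≤ -2 α g`. Hence each
form `vᵀ P v` changes at a relative rate of at most `c exp (-α t)`, which is integrable: it
converges, and its limit is positive for `v ≠ 0`. The velocity tends to zero, so the limit is an
equilibrium (`exists_tendsto_riccati`).

For uniqueness, the difference `Z` of two equilibria solves a Sylvester equation. A weighted trace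
of it, combined with the domination at the limit, forces `Z = 0` (`riccatiField_eq_zero_unique`). -/

noncomputable section

namespace ISKF

/-! ### Quadratic forms, traces and weighted Frobenius norms -/

section QuadraticForms

variable {ι κ : Type*} [Fintype ι] [Fintype κ]

lemma dotProduct_mulVec_comm_of_transpose_eq {M : Matrix ι ι ℝ} (hM : Mᵀ = M) (u v : ι → ℝ) :
    u ⬝ᵥ M *ᵥ v = v ⬝ᵥ M *ᵥ u := by
  conv_lhs => rw [dotProduct_comm, ← hM, mulVec_transpose, ← dotProduct_mulVec]

lemma transpose_eq_of_posSemidef {ι : Type*} {M : Matrix ι ι ℝ} (hM : M.PosSemidef) : Mᵀ = M := by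
  simpa [IsHermitian, conjTranspose_eq_transpose_of_trivial] using hM.isHermitian

lemma posSemidef_of_quadratic_nonneg {M : Matrix ι ι ℝ} (hM : Mᵀ = M)
    (h : ∀ v : ι → ℝ, 0 ≤ v ⬝ᵥ M *ᵥ v) : M.PosSemidef :=
  .of_dotProduct_mulVec_nonneg (by rwa [IsHermitian, conjTranspose_eq_transpose_of_trivial])
    (fun v => by simpa using h v)

lemma posDef_of_quadratic_pos {M : Matrix ι ι ℝ} (hM : Mᵀ = M)
    (h : ∀ v : ι → ℝ, v ≠ 0 → 0 < v ⬝ᵥ M *ᵥ v) : M.PosDef :=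
  .of_dotProduct_mulVec_pos (by rwa [IsHermitian, conjTranspose_eq_transpose_of_trivial])
    (fun v hv => by simpa using h v hv)

lemma quadratic_nonneg {M : Matrix ι ι ℝ} (hM : M.PosSemidef) (v : ι → ℝ) :
    0 ≤ v ⬝ᵥ M *ᵥ v := by
  simpa using hM.dotProduct_mulVec_nonneg v

lemma quadratic_pos {M : Matrix ι ι ℝ} (hM : M.PosDef) {v : ι → ℝ} (hv : v ≠ 0) :
    0 < v ⬝ᵥ M *ᵥ v := by
  simpa using hM.dotProduct_mulVec_pos hv

lemma exists_transpose_mul_self_eq {M : Matrix ι ι ℝ} (hM : M.PosSemidef) :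
    ∃ B : Matrix ι ι ℝ, M = Bᵀ * B := by
  classical
  open scoped MatrixOrder in
  obtain ⟨B, hB⟩ := CStarAlgebra.nonneg_iff_eq_star_mul_self.mp hM.nonneg
  exact ⟨B, by simpa [star_eq_conjTranspose, conjTranspose_eq_transpose_of_trivial] using hB⟩

lemma quadratic_transpose_mul_self (B : Matrix κ ι ℝ) (v : ι → ℝ) :
    v ⬝ᵥ (Bᵀ * B) *ᵥ v = (B *ᵥ v) ⬝ᵥ (B *ᵥ v) := by
  rw [← mulVec_mulVec, mulVec_transpose, dotProduct_comm, ← dotProduct_mulVec]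

/-- Cauchy–Schwarz in every row; `trace (Mᵀ * M)` is the squared Frobenius norm. Traces serve as
norms throughout because they are polynomial in the entries, hence easy to differentiate and pass to
limits. -/
lemma mulVec_dotProduct_self_le (M : Matrix κ ι ℝ) (u : ι → ℝ) :
    (M *ᵥ u) ⬝ᵥ (M *ᵥ u) ≤ trace (Mᵀ * M) * (u ⬝ᵥ u) := by
  have h : trace (Mᵀ * M) = ∑ i, ∑ j, M i j ^ 2 := by
    rw [trace_mul_comm]
    simp [trace, mul_apply, sq]
  rw [h, Finset.sum_mul]
  refine Finset.sum_le_sum fun i _ => ?_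
  have := Finset.sum_mul_sq_le_sq_mul_sq Finset.univ (M i) u
  simpa [mulVec, dotProduct, sq] using this

lemma abs_quadratic_le (M : Matrix ι ι ℝ) (u : ι → ℝ) :
    |u ⬝ᵥ M *ᵥ u| ≤ √(trace (Mᵀ * M)) * (u ⬝ᵥ u) := by
  have h0 : 0 ≤ u ⬝ᵥ u := by simpa using dotProduct_star_self_nonneg u
  have h1 : (u ⬝ᵥ M *ᵥ u) ^ 2 ≤ (u ⬝ᵥ u) * ((M *ᵥ u) ⬝ᵥ (M *ᵥ u)) := by
    have := Finset.sum_mul_sq_le_sq_mul_sq Finset.univ u (M *ᵥ u)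
    simpa [dotProduct, sq] using this
  have h2 := mulVec_dotProduct_self_le M u
  refine abs_le_of_sq_le_sq ?_ (by positivity)
  have ht : 0 ≤ trace (Mᵀ * M) := by
    simpa [conjTranspose_eq_transpose_of_trivial] using
      (posSemidef_conjTranspose_mul_self M).trace_nonneg
  rw [mul_pow, Real.sq_sqrt ht]
  nlinarith

lemma trace_mul_nonneg {M N : Matrix ι ι ℝ} (hM : M.PosSemidef) (hN : N.PosSemidef) :
    0 ≤ trace (M * N) := by
  obtain ⟨B, rfl⟩ := exists_transpose_mul_self_eq hN
  rw [← Matrix.mul_assoc, trace_mul_comm, ← Matrix.mul_assoc]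
  simpa [conjTranspose_eq_transpose_of_trivial] using
    (hM.mul_mul_conjTranspose_same B).trace_nonneg

lemma posSemidef_mul_mul_transpose {M : Matrix ι ι ℝ} (hM : M.PosSemidef) (B : Matrix κ ι ℝ) :
    (B * M * Bᵀ).PosSemidef := by
  simpa [conjTranspose_eq_transpose_of_trivial] using hM.mul_mul_conjTranspose_same B

lemma posSemidef_transpose_mul_mul {M : Matrix ι ι ℝ} (hM : M.PosSemidef) (B : Matrix ι κ ℝ) :
    (Bᵀ * M * B).PosSemidef := by
  simpa [conjTranspose_eq_transpose_of_trivial] using hM.conjTranspose_mul_mul_same B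

/-- With `P = Bᵀ B` and `H = Nᵀ N` this bounds `N Bᵀ` applied to `B z` by its Frobenius norm. It
makes the quadratic Riccati term relatively bounded by `P`, even where `P` is singular. -/
lemma quadratic_mul_mul_le {P H : Matrix ι ι ℝ} (hP : P.PosSemidef) (hH : H.PosSemidef)
    (z : ι → ℝ) : z ⬝ᵥ (P * H * P) *ᵥ z ≤ trace (H * P) * (z ⬝ᵥ P *ᵥ z) := by
  obtain ⟨B, rfl⟩ := exists_transpose_mul_self_eq hP
  obtain ⟨N, rfl⟩ := exists_transpose_mul_self_eq hH
  have h := mulVec_dotProduct_self_le (N * Bᵀ) (B *ᵥ z)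
  have h1 : Bᵀ * B * (Nᵀ * N) * (Bᵀ * B) = (N * Bᵀ * B)ᵀ * (N * Bᵀ * B) := by
    simp only [transpose_mul, transpose_transpose, Matrix.mul_assoc]
  have h2 : trace (Nᵀ * N * (Bᵀ * B)) = trace ((N * Bᵀ)ᵀ * (N * Bᵀ)) := by
    rw [← Matrix.mul_assoc, trace_mul_comm]
    simp only [transpose_mul, transpose_transpose, Matrix.mul_assoc]
  rw [h1, h2, quadratic_transpose_mul_self, quadratic_transpose_mul_self]
  simpa only [mulVec_mulVec] using h

variable [DecidableEq ι]

lemma det_isUnit_of_posDef {P : Matrix ι ι ℝ} (hP : P.PosDef) : IsUnit P.det :=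
  (isUnit_iff_isUnit_det P).mp hP.isUnit

lemma exists_isUnit_transpose_mul_self_eq {P : Matrix ι ι ℝ} (hP : P.PosDef) :
    ∃ B : Matrix ι ι ℝ, IsUnit B.det ∧ P = Bᵀ * B := by
  obtain ⟨B, hB⟩ := exists_transpose_mul_self_eq hP.posSemidef
  refine ⟨B, ?_, hB⟩
  have := det_isUnit_of_posDef hP
  rw [hB, det_mul] at this
  exact isUnit_of_mul_isUnit_right this

lemma dotProduct_self_le_trace_inv_mul {P : Matrix ι ι ℝ} (hP : P.PosDef) (v : ι → ℝ) :
    v ⬝ᵥ v ≤ trace P⁻¹ * (v ⬝ᵥ P *ᵥ v) := by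
  obtain ⟨B, hB, rfl⟩ := exists_isUnit_transpose_mul_self_eq hP
  have h := mulVec_dotProduct_self_le B⁻¹ (B *ᵥ v)
  rw [mulVec_mulVec, nonsing_inv_mul _ hB, one_mulVec, trace_mul_comm] at h
  rwa [quadratic_transpose_mul_self, Matrix.mul_inv_rev, ← transpose_nonsing_inv]

/-- The form `Y` is dominated by `P`, with the `P`-weighted Frobenius norm of `Y` as constant. -/
lemma abs_quadratic_le_weighted {P Y : Matrix ι ι ℝ} (hP : P.PosDef) (hY : Yᵀ = Y) (v : ι → ℝ) :
    |v ⬝ᵥ Y *ᵥ v| ≤ √(trace (P⁻¹ * Y * P⁻¹ * Y)) * (v ⬝ᵥ P *ᵥ v) := by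
  obtain ⟨B, hB, rfl⟩ := exists_isUnit_transpose_mul_self_eq hP
  have h := abs_quadratic_le ((B⁻¹)ᵀ * Y * B⁻¹) (B *ᵥ v)
  have h1 : (B *ᵥ v) ⬝ᵥ ((B⁻¹)ᵀ * Y * B⁻¹) *ᵥ (B *ᵥ v) = v ⬝ᵥ Y *ᵥ v := by
    rw [mulVec_mulVec, Matrix.mul_assoc, nonsing_inv_mul _ hB, Matrix.mul_one,
      ← mulVec_mulVec, dotProduct_mulVec, vecMul_transpose, mulVec_mulVec,
      nonsing_inv_mul _ hB, one_mulVec]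
  have h2 : trace (((B⁻¹)ᵀ * Y * B⁻¹)ᵀ * ((B⁻¹)ᵀ * Y * B⁻¹))
      = trace ((Bᵀ * B)⁻¹ * Y * (Bᵀ * B)⁻¹ * Y) := by
    rw [trace_mul_comm]
    simp only [transpose_mul, transpose_transpose, hY, Matrix.mul_inv_rev, transpose_nonsing_inv,
      Matrix.mul_assoc]
    rw [trace_mul_comm]
    simp only [Matrix.mul_assoc]
    rw [trace_mul_comm]
    simp only [Matrix.mul_assoc]
  rwa [h1, h2, ← quadratic_transpose_mul_self] at h

end QuadraticForms

/-! ### Calculus of matrix-valued functions -/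

section MatrixCalculus

lemma hasDerivWithinAt_matrix_congr {ι : Type*} {P : ℝ → Matrix ι ι ℝ} {P' N' : Matrix ι ι ℝ}
    {s : Set ℝ} {t : ℝ} (h : HasDerivWithinAt P P' s t) (e : P' = N') :
    HasDerivWithinAt P N' s t := e ▸ h

variable {ι : Type*} [Fintype ι] {P N : ℝ → Matrix ι ι ℝ} {P' N' : Matrix ι ι ℝ} {s : Set ℝ} {t : ℝ}

lemma hasDerivWithinAt_matrix
    (h : ∀ i j, HasDerivWithinAt (fun u => P u i j) (P' i j) s t) : HasDerivWithinAt P P' s t :=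
  hasDerivWithinAt_pi.2 fun i => hasDerivWithinAt_pi.2 fun j => h i j

lemma hasDerivWithinAt_entry (h : HasDerivWithinAt P P' s t) (i j : ι) :
    HasDerivWithinAt (fun u => P u i j) (P' i j) s t :=
  hasDerivWithinAt_pi.1 (hasDerivWithinAt_pi.1 h i) j

lemma continuousWithinAt_of_hasDerivWithinAt_matrix (h : HasDerivWithinAt P P' s t) :
    ContinuousWithinAt P s t :=
  continuousWithinAt_pi.2 fun i => continuousWithinAt_pi.2 fun j =>
    (hasDerivWithinAt_entry h i j).continuousWithinAt

lemma hasDerivWithinAt_matrix_mul (hP : HasDerivWithinAt P P' s t)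
    (hN : HasDerivWithinAt N N' s t) :
    HasDerivWithinAt (fun u => P u * N u) (P' * N t + P t * N') s t := by
  refine hasDerivWithinAt_matrix fun i j => ?_
  simp only [mul_apply, Matrix.add_apply, ← Finset.sum_add_distrib]
  exact HasDerivWithinAt.fun_sum fun k _ =>
    (hasDerivWithinAt_entry hP i k).fun_mul (hasDerivWithinAt_entry hN k j)

lemma hasDerivWithinAt_matrix_const (M : Matrix ι ι ℝ) :
    HasDerivWithinAt (fun _ => M) 0 s t :=
  hasDerivWithinAt_matrix fun _ _ => hasDerivWithinAt_const _ _ _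

lemma hasDerivWithinAt_matrix_add (hP : HasDerivWithinAt P P' s t)
    (hN : HasDerivWithinAt N N' s t) :
    HasDerivWithinAt (fun u => P u + N u) (P' + N') s t :=
  hasDerivWithinAt_matrix fun i j =>
    (hasDerivWithinAt_entry hP i j).add (hasDerivWithinAt_entry hN i j)

lemma hasDerivWithinAt_matrix_sub (hP : HasDerivWithinAt P P' s t)
    (hN : HasDerivWithinAt N N' s t) :
    HasDerivWithinAt (fun u => P u - N u) (P' - N') s t :=
  hasDerivWithinAt_matrix fun i j =>
    (hasDerivWithinAt_entry hP i j).sub (hasDerivWithinAt_entry hN i j)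

lemma hasDerivWithinAt_trace (h : HasDerivWithinAt P P' s t) :
    HasDerivWithinAt (fun u => trace (P u)) (trace P') s t :=
  HasDerivWithinAt.fun_sum fun i _ => hasDerivWithinAt_entry h i i

lemma hasDerivWithinAt_transpose (h : HasDerivWithinAt P P' s t) :
    HasDerivWithinAt (fun u => (P u)ᵀ) P'ᵀ s t :=
  hasDerivWithinAt_matrix fun i j => hasDerivWithinAt_entry h j i

lemma hasDerivWithinAt_quadratic (h : HasDerivWithinAt P P' s t) (v : ι → ℝ) :
    HasDerivWithinAt (fun u => v ⬝ᵥ P u *ᵥ v) (v ⬝ᵥ P' *ᵥ v) s t := by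
  simp only [dotProduct, mulVec]
  exact HasDerivWithinAt.fun_sum fun i _ => HasDerivWithinAt.const_mul _
    (HasDerivWithinAt.fun_sum fun j _ => (hasDerivWithinAt_entry h i j).mul_const _)

lemma hasDerivWithinAt_inv [DecidableEq ι] (h : HasDerivWithinAt P P' s t) (hu : IsUnit (P t)) :
    HasDerivWithinAt (fun u => (P u)⁻¹) (-((P t)⁻¹ * P' * (P t)⁻¹)) s t := by
  open scoped Matrix.Norms.Operator in
  obtain ⟨x, hx⟩ := hu
  have h1 := hasFDerivAt_ringInverse (𝕜 := ℝ) x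
  rw [hx] at h1
  have h2 := h1.comp_hasDerivWithinAt t h
  have h3 : (fun u => (P u)⁻¹) = Ring.inverse ∘ P :=
    funext fun u => nonsing_inv_eq_ringInverse _
  rw [h3, nonsing_inv_eq_ringInverse, ← hx, Ring.inverse_unit]
  exact h2

lemma hasDerivWithinAt_exp_sub_smul [DecidableEq ι] (A : Matrix ι ι ℝ) (T : ℝ) :
    HasDerivWithinAt (fun u : ℝ => NormedSpace.exp ((u - T) • A))
      (NormedSpace.exp ((t - T) • A) * A) s t := by
  open scoped Matrix.Norms.Operator in
  have h1 := (hasDerivAt_exp_smul_const (𝕂 := ℝ) A (t - T)).scomp t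
    ((hasDerivAt_id t).sub_const T)
  rw [one_smul] at h1
  exact h1.hasDerivWithinAt

/-- Conjugation by the flow of `-A` removes the drift `A X + X Aᵀ` from a matrix equation. -/
lemma hasDerivWithinAt_conj_exp [DecidableEq ι] {A G : Matrix ι ι ℝ} (T : ℝ)
    (hP : HasDerivWithinAt P (A * P t + P t * Aᵀ + G) s t) :
    HasDerivWithinAt
      (fun u => NormedSpace.exp ((u - T) • (-A)) * P u * (NormedSpace.exp ((u - T) • (-A)))ᵀ)
      (NormedSpace.exp ((t - T) • (-A)) * G * (NormedSpace.exp ((t - T) • (-A)))ᵀ) s t := by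
  have hE := hasDerivWithinAt_exp_sub_smul (s := s) (t := t) (-A) T
  refine hasDerivWithinAt_matrix_congr (hasDerivWithinAt_matrix_mul
    (hasDerivWithinAt_matrix_mul hE hP) (hasDerivWithinAt_transpose hE)) ?_
  simp only [transpose_mul, transpose_neg]
  noncomm_ring

lemma monotoneOn_of_hasDerivWithinAt_Ici {f f' : ℝ → ℝ} {s : Set ℝ} (hs : Convex ℝ s)
    (hs0 : s ⊆ Ici 0) (h : ∀ t ∈ s, HasDerivWithinAt f (f' t) (Ici 0) t)
    (h' : ∀ t ∈ s, 0 ≤ f' t) : MonotoneOn f s :=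
  monotoneOn_of_hasDerivWithinAt_nonneg (f' := f') hs
    (fun t ht => (h t ht).continuousWithinAt.mono hs0)
    (fun t ht => (h t (interior_subset ht)).mono (interior_subset.trans hs0))
    (fun t ht => h' t (interior_subset ht))

end MatrixCalculus

/-! ### Symmetry and positive definiteness along the Riccati flow -/

section RiccatiFlow

variable {ι : Type*} [Fintype ι] [DecidableEq ι]

/-- Since `P H Pᵀ` is symmetric for every `P`, it cancels in the equation of `Pᵀ - P`, which is
therefore linear and homogeneous. Conjugated by the flow of `-A`, the difference is constant, and it
vanishes at time `0`. -/
lemma transpose_eq_of_riccati {A Q H : Matrix ι ι ℝ} {P : ℝ → Matrix ι ι ℝ}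
    (hQ : Qᵀ = Q) (hH : Hᵀ = H) (hP0 : (P 0)ᵀ = P 0)
    (hP : ∀ t, 0 ≤ t →
      HasDerivWithinAt P (A * P t + P t * Aᵀ + Q - P t * H * (P t)ᵀ) (Ici 0) t)
    {T : ℝ} (hT : 0 ≤ T) : (P T)ᵀ = P T := by
  have hZ (t : ℝ) (ht : t ∈ Icc 0 T) : HasDerivWithinAt (fun u => (P u)ᵀ - P u)
      (A * ((P t)ᵀ - P t) + ((P t)ᵀ - P t) * Aᵀ + 0) (Ici 0) t := by
    refine hasDerivWithinAt_matrix_congr (hasDerivWithinAt_matrix_sub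
      (hasDerivWithinAt_transpose (hP t ht.1)) (hP t ht.1)) ?_
    simp only [transpose_sub, transpose_add, transpose_mul, transpose_transpose, hQ, hH]
    noncomm_ring
  have hX (t : ℝ) (ht : t ∈ Icc 0 T) := hasDerivWithinAt_conj_exp T (hZ t ht)
  ext i j
  have h0 : (0 : ℝ) ∈ Icc 0 T := ⟨le_rfl, hT⟩
  have hT' : T ∈ Icc 0 T := ⟨hT, le_rfl⟩
  have hc := constant_of_has_deriv_right_zero (a := 0) (b := T)
    (fun t ht => ((hasDerivWithinAt_entry (hX t ht) i j).continuousWithinAt).mono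
      Icc_subset_Ici_self)
    (fun t ht => ((hasDerivWithinAt_entry (hX t ⟨ht.1, ht.2.le⟩) i j).mono
      (Ici_subset_Ici.2 ht.1)).congr_deriv (by simp)) T hT'
  simp only [hP0, sub_self, Matrix.mul_zero, Matrix.zero_mul, zero_smul, NormedSpace.exp_zero,
    transpose_one, Matrix.mul_one, Matrix.one_mul, Matrix.sub_apply, Matrix.zero_apply] at hc
  exact sub_eq_zero.1 hc

/-- Positive definiteness is an open condition along a continuous path of symmetric matrices. -/
lemma eventually_posDef {P : ℝ → Matrix ι ι ℝ} {s : Set ℝ} {t : ℝ}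
    (hc : ContinuousWithinAt P s t) (hsym : ∀ u ∈ s, (P u)ᵀ = P u) (hpos : (P t).PosDef) :
    ∀ᶠ u in 𝓝[s] t, (P u).PosDef := by
  have hf : ContinuousWithinAt
      (fun u => trace (P t)⁻¹ * √(trace ((P u - P t)ᵀ * (P u - P t)))) s t := by
    fun_prop
  have h0 : trace (P t)⁻¹ * √(trace ((P t - P t)ᵀ * (P t - P t))) < 1 := by simp
  filter_upwards [hf.eventually_lt continuousWithinAt_const h0, self_mem_nhdsWithin] with u hu hus
  refine posDef_of_quadratic_pos (hsym u hus) fun v hv => ?_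
  -- The perturbation `P u - P t` is less than `P t` as a form, since its Frobenius norm times
  -- `trace (P t)⁻¹` is below `1`.
  have h1 := abs_le.1 (abs_quadratic_le (P u - P t) v)
  have h2 := dotProduct_self_le_trace_inv_mul hpos v
  have h3 := quadratic_pos hpos hv
  have h4 : v ⬝ᵥ (P u - P t) *ᵥ v = v ⬝ᵥ P u *ᵥ v - v ⬝ᵥ P t *ᵥ v := by
    rw [sub_mulVec, dotProduct_sub]
  have h5 := mul_le_mul_of_nonneg_left h2 (Real.sqrt_nonneg (trace ((P u - P t)ᵀ * (P u - P t))))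
  have h6 := mul_lt_mul_of_pos_right hu h3
  nlinarith [h1.1]

/-- A solution that is positive semidefinite on `[0, T]` is positive definite at `T`: along
`z' = -Aᵀ z` the form `zᵀ P z` decays at most exponentially. -/
lemma posDef_of_riccati_of_posSemidef {A Q H : Matrix ι ι ℝ} {P : ℝ → Matrix ι ι ℝ}
    (hQ : Q.PosSemidef) (hH : H.PosSemidef) (hP0 : (P 0).PosDef)
    (hP : ∀ t, 0 ≤ t → HasDerivWithinAt P (A * P t + P t * Aᵀ + Q - P t * H * P t) (Ici 0) t)
    {T : ℝ} (hT : 0 ≤ T) (hpsd : ∀ t ∈ Icc 0 T, (P t).PosSemidef) : (P T).PosDef := by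
  refine posDef_of_quadratic_pos (transpose_eq_of_posSemidef (hpsd T ⟨hT, le_rfl⟩)) fun v hv => ?_
  have hc : ContinuousOn P (Icc 0 T) := fun t ht =>
    (continuousWithinAt_of_hasDerivWithinAt_matrix (hP t ht.1)).mono Icc_subset_Ici_self
  have hKc : ContinuousOn (fun t => trace (H * P t)) (Icc 0 T) := by fun_prop
  obtain ⟨K, hK⟩ := isCompact_Icc.bddAbove_image hKc
  -- Here `z = (E t)ᵀ v` solves `z' = -Aᵀ z` with `z T = v`, so that the drift drops out of the
  -- derivative of `f = zᵀ P z`.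
  let E : ℝ → Matrix ι ι ℝ := fun t => NormedSpace.exp ((t - T) • (-A))
  have hquad (t : ℝ) (M : Matrix ι ι ℝ) :
      v ⬝ᵥ (E t * M * (E t)ᵀ) *ᵥ v = ((E t)ᵀ *ᵥ v) ⬝ᵥ M *ᵥ ((E t)ᵀ *ᵥ v) := by
    rw [Matrix.mul_assoc, ← mulVec_mulVec, dotProduct_mulVec, ← mulVec_transpose, mulVec_mulVec]
  let f : ℝ → ℝ := fun t => ((E t)ᵀ *ᵥ v) ⬝ᵥ P t *ᵥ ((E t)ᵀ *ᵥ v)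
  have hf (t : ℝ) (ht : t ∈ Icc 0 T) : HasDerivWithinAt f
      (((E t)ᵀ *ᵥ v) ⬝ᵥ (Q - P t * H * P t) *ᵥ ((E t)ᵀ *ᵥ v)) (Ici 0) t := by
    have h1 : HasDerivWithinAt P (A * P t + P t * Aᵀ + (Q - P t * H * P t)) (Ici 0) t :=
      hasDerivWithinAt_matrix_congr (hP t ht.1) (by abel)
    have h2 := hasDerivWithinAt_quadratic (hasDerivWithinAt_conj_exp T h1) v
    have h3 : f = fun u => v ⬝ᵥ (E u * P u * (E u)ᵀ) *ᵥ v := funext fun u => (hquad u _).symm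
    rw [h3, ← hquad]
    exact h2
  -- `f' = zᵀ (Q - P H P) z ≥ -K f`, where `K` bounds `trace (H * P t)` on `[0, T]`.
  have hmono : MonotoneOn (fun t => Real.exp (K * t) * f t) (Icc 0 T) := by
    refine monotoneOn_of_hasDerivWithinAt_Ici (convex_Icc 0 T) Icc_subset_Ici_self
      (fun t ht => ((((hasDerivAt_id t).const_mul K).exp).hasDerivWithinAt).mul (hf t ht)) ?_
    intro t ht
    have h1 := quadratic_mul_mul_le (hpsd t ht) hH ((E t)ᵀ *ᵥ v)
    have h2 := quadratic_nonneg hQ ((E t)ᵀ *ᵥ v)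
    have h3 := quadratic_nonneg (hpsd t ht) ((E t)ᵀ *ᵥ v)
    have h4 : trace (H * P t) ≤ K := hK (mem_image_of_mem _ ht)
    have h5 := mul_le_mul_of_nonneg_right h4 h3
    have h6 : 0 ≤ K * f t + ((E t)ᵀ *ᵥ v) ⬝ᵥ (Q - P t * H * P t) *ᵥ ((E t)ᵀ *ᵥ v) := by
      rw [sub_mulVec, dotProduct_sub]
      simp only [f]
      linarith
    have h7 := mul_nonneg (Real.exp_pos (K * t)).le h6
    simp only [id]
    linarith
  have hle := hmono ⟨le_rfl, hT⟩ ⟨hT, le_rfl⟩ hT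
  have hE0 : IsUnit (E 0) := by
    simpa only [E] using Matrix.isUnit_exp _
  have hz : (E 0)ᵀ *ᵥ v ≠ 0 := by
    intro h
    apply hv
    have hu : IsUnit (E 0)ᵀ := by simpa using hE0
    exact (mulVec_injective_iff_isUnit.2 hu) (by rw [h, mulVec_zero])
  have hpos := quadratic_pos hP0 hz
  have hfT : f T = v ⬝ᵥ P T *ᵥ v := by simp [f, E]
  simp only [mul_zero, Real.exp_zero, one_mul, hfT] at hle
  exact (pos_iff_pos_of_mul_pos (hpos.trans_le hle)).1 (Real.exp_pos _)

/-- At the infimum of the times of failure, `P` is positive semidefinite by closedness, hence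
positive definite by the preceding lemma, hence positive definite a little later, which contradicts
the infimum. -/
lemma posDef_of_riccati {A Q H : Matrix ι ι ℝ} {P : ℝ → Matrix ι ι ℝ}
    (hQ : Q.PosSemidef) (hH : H.PosSemidef) (hP0 : (P 0).PosDef)
    (hsym : ∀ t, 0 ≤ t → (P t)ᵀ = P t)
    (hP : ∀ t, 0 ≤ t → HasDerivWithinAt P (A * P t + P t * Aᵀ + Q - P t * H * P t) (Ici 0) t)
    {T : ℝ} (hT : 0 ≤ T) : (P T).PosDef := by
  have hc (t : ℝ) (ht : 0 ≤ t) : ContinuousWithinAt P (Ici 0) t :=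
    continuousWithinAt_of_hasDerivWithinAt_matrix (hP t ht)
  by_contra hbad
  let B : Set ℝ := {t | 0 ≤ t ∧ ¬ (P t).PosDef}
  have hBne : B.Nonempty := ⟨T, hT, hbad⟩
  have hBbdd : BddBelow B := ⟨0, fun t ht => ht.1⟩
  set τ := sInf B
  have hτ : 0 ≤ τ := le_csInf hBne fun t ht => ht.1
  have hlt (t : ℝ) (ht : 0 ≤ t) (htτ : t < τ) : (P t).PosDef := by
    by_contra h
    exact (csInf_le hBbdd ⟨ht, h⟩).not_gt htτ
  have hpsdτ : (P τ).PosSemidef := by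
    rcases hτ.eq_or_lt with h | h
    · exact h ▸ hP0.posSemidef
    refine posSemidef_of_quadratic_nonneg (hsym τ hτ) fun v => ?_
    have hcv : ContinuousWithinAt (fun t => v ⬝ᵥ P t *ᵥ v) (Ico 0 τ) τ :=
      (hasDerivWithinAt_quadratic (hP τ hτ) v).continuousWithinAt.mono Ico_subset_Ici_self
    have : (𝓝[Ico 0 τ] τ).NeBot := by
      rw [← mem_closure_iff_nhdsWithin_neBot, closure_Ico h.ne]
      exact ⟨hτ, le_rfl⟩
    exact ge_of_tendsto hcv (eventually_mem_nhdsWithin.mono fun t ht =>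
      quadratic_nonneg (hlt t ht.1 ht.2).posSemidef v)
  have hposτ : (P τ).PosDef := posDef_of_riccati_of_posSemidef hQ hH hP0 hP hτ fun t ht => by
    rcases ht.2.eq_or_lt with h | h
    · exact h ▸ hpsdτ
    · exact (hlt t ht.1 h).posSemidef
  have hev := eventually_posDef (hc τ hτ) (fun u hu => hsym u hu) hposτ
  obtain ⟨δ, hδ, hball⟩ := Metric.mem_nhdsWithin_iff.1 hev
  obtain ⟨b, hb, hbτ⟩ := exists_lt_of_csInf_lt hBne (lt_add_of_pos_right τ hδ)
  refine hb.2 (hball ⟨?_, hb.1⟩)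
  have := csInf_le hBbdd hb
  rw [Metric.mem_ball, Real.dist_eq, abs_of_nonneg (sub_nonneg.2 this)]
  linarith

end RiccatiFlow

/-! ### Convergence of the Riccati flow and uniqueness of its equilibrium -/

section RiccatiConvergence

variable {ι : Type*} [Fintype ι]

/-- The field `A P + P Aᵀ + Q - P H P` of a Riccati equation, in terms of `H = Cᵀ R⁻¹ C`. -/
def riccatiField (A Q H P : Matrix ι ι ℝ) : Matrix ι ι ℝ :=
  A * P + P * Aᵀ + Q - P * H * P

lemma riccatiField_transpose {A Q H P : Matrix ι ι ℝ} (hQ : Qᵀ = Q) (hH : Hᵀ = H) (hP : Pᵀ = P) :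
    (riccatiField A Q H P)ᵀ = riccatiField A Q H P := by
  simp only [riccatiField, transpose_sub, transpose_add, transpose_mul, transpose_transpose, hQ,
    hH, hP, Matrix.mul_assoc]
  abel

lemma hasDerivWithinAt_riccatiField {A Q H P' : Matrix ι ι ℝ} {P : ℝ → Matrix ι ι ℝ} {s : Set ℝ}
    {t : ℝ} (hP : HasDerivWithinAt P P' s t) :
    HasDerivWithinAt (fun u => riccatiField A Q H (P u))
      (A * P' + P' * Aᵀ - P' * H * P t - P t * H * P') s t := by
  have hc (M : Matrix ι ι ℝ) := hasDerivWithinAt_matrix_const (s := s) (t := t) M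
  refine hasDerivWithinAt_matrix_congr (hasDerivWithinAt_matrix_sub
    (hasDerivWithinAt_matrix_add (hasDerivWithinAt_matrix_add
      (hasDerivWithinAt_matrix_mul (hc A) hP) (hasDerivWithinAt_matrix_mul hP (hc Aᵀ))) (hc Q))
    (hasDerivWithinAt_matrix_mul (hasDerivWithinAt_matrix_mul hP (hc H)) hP)) ?_
  noncomm_ring

variable [DecidableEq ι]

lemma inv_mul_riccatiField_mul_inv {A Q H P : Matrix ι ι ℝ} (hP : IsUnit P.det) :
    P⁻¹ * riccatiField A Q H P * P⁻¹ = P⁻¹ * A + Aᵀ * P⁻¹ + P⁻¹ * Q * P⁻¹ - H := by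
  have h1 : P⁻¹ * P = 1 := nonsing_inv_mul _ hP
  have h2 : P * P⁻¹ = 1 := mul_nonsing_inv _ hP
  calc P⁻¹ * riccatiField A Q H P * P⁻¹
      = P⁻¹ * A * (P * P⁻¹) + (P⁻¹ * P) * Aᵀ * P⁻¹ + P⁻¹ * Q * P⁻¹
        - (P⁻¹ * P) * H * (P * P⁻¹) := by
          simp only [riccatiField]
          noncomm_ring
    _ = _ := by rw [h1, h2, Matrix.mul_one, Matrix.one_mul, Matrix.one_mul, Matrix.mul_one]

/-- The left side is the product rule for `tr (P⁻¹ Y P⁻¹ Y)` along the flow. Replacing one factor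
`P⁻¹ Y P⁻¹` by its expression through `A`, `Q`, `H` cancels every term in `A`. -/
lemma trace_weighted_deriv {A Q H P Y : Matrix ι ι ℝ} (hP : IsUnit P.det)
    (hY : riccatiField A Q H P = Y) :
    trace (((-(P⁻¹ * Y * P⁻¹) * Y + P⁻¹ * (A * Y + Y * Aᵀ - Y * H * P - P * H * Y)) * P⁻¹
        + P⁻¹ * Y * -(P⁻¹ * Y * P⁻¹)) * Y
        + P⁻¹ * Y * P⁻¹ * (A * Y + Y * Aᵀ - Y * H * P - P * H * Y))
      = -2 * trace ((P⁻¹ * Q * P⁻¹ + H) * (Y * P⁻¹ * Y)) := by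
  have h1 : P⁻¹ * P = 1 := nonsing_inv_mul _ hP
  have h2 : P * P⁻¹ = 1 := mul_nonsing_inv _ hP
  have hYinv : P⁻¹ * Y * P⁻¹ = P⁻¹ * A + Aᵀ * P⁻¹ + P⁻¹ * Q * P⁻¹ - H := by
    rw [← hY, inv_mul_riccatiField_mul_inv hP]
  set Pi := P⁻¹
  set Y' := A * Y + Y * Aᵀ - Y * H * P - P * H * Y with hY'
  set W := Y * Pi * Y with hW
  have e1 : trace (((-(Pi * Y * Pi) * Y + Pi * Y') * Pi + Pi * Y * -(Pi * Y * Pi)) * Y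
        + Pi * Y * Pi * Y') = -2 * trace ((Pi * Y * Pi) * W) + 2 * trace (Pi * Y' * Pi * Y) := by
    have c1 : trace (Pi * Y * Pi * Y') = trace (Pi * Y' * Pi * Y) := by
      rw [Matrix.mul_assoc (Pi * Y), trace_mul_comm, ← Matrix.mul_assoc]
    have c2 : ((-(Pi * Y * Pi) * Y + Pi * Y') * Pi + Pi * Y * -(Pi * Y * Pi)) * Y
        + Pi * Y * Pi * Y' = -((Pi * Y * Pi) * W) - (Pi * Y * Pi) * W + Pi * Y' * Pi * Y
          + Pi * Y * Pi * Y' := by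
      rw [hW]; noncomm_ring
    rw [c2, trace_add, trace_add, trace_sub, trace_neg, c1]
    ring
  have e2 : Pi * Y' * Pi * Y = Pi * A * W + (Pi * Y) * (Aᵀ * Pi * Y) - (Pi * Y) * (H * Y)
      - H * W := by
    calc Pi * Y' * Pi * Y = Pi * A * W + (Pi * Y) * (Aᵀ * Pi * Y)
          - (Pi * Y) * (H * (P * Pi) * Y) - (Pi * P) * H * W := by
            rw [hY', hW]; noncomm_ring
      _ = _ := by rw [h1, h2, Matrix.mul_one, Matrix.one_mul]
  have e3 : trace ((Pi * Y) * (Aᵀ * Pi * Y)) = trace (Aᵀ * Pi * W) := by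
    rw [trace_mul_comm, hW]; simp only [Matrix.mul_assoc]
  have e4 : trace ((Pi * Y) * (H * Y)) = trace (H * W) := by
    rw [trace_mul_comm, hW]; simp only [Matrix.mul_assoc]
  rw [e1, e2, hYinv]
  simp only [Matrix.add_mul, Matrix.sub_mul, trace_add, trace_sub, e3, e4]
  ring

lemma posSemidef_inv_conj {Q H P : Matrix ι ι ℝ} {α : ℝ} (hP : P.PosDef)
    (h : (Q + P * H * P - α • P).PosSemidef) : (P⁻¹ * Q * P⁻¹ + H - α • P⁻¹).PosSemidef := by
  have h1 : P⁻¹ * P = 1 := nonsing_inv_mul _ (det_isUnit_of_posDef hP)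
  have h2 : P * P⁻¹ = 1 := mul_nonsing_inv _ (det_isUnit_of_posDef hP)
  have h3 := posSemidef_mul_mul_transpose h P⁻¹
  rw [transpose_eq_of_posSemidef hP.inv.posSemidef] at h3
  convert h3 using 1
  calc P⁻¹ * Q * P⁻¹ + H - α • P⁻¹
      = P⁻¹ * Q * P⁻¹ + (P⁻¹ * P) * H * (P * P⁻¹) - α • (P⁻¹ * P * P⁻¹) := by
        rw [h1, h2, Matrix.one_mul, Matrix.mul_one, Matrix.one_mul]
    _ = _ := by
        simp only [Matrix.mul_add, Matrix.mul_sub, Matrix.add_mul, Matrix.sub_mul, Matrix.mul_smul,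
          Matrix.smul_mul, Matrix.mul_assoc]

/-- The weighted Frobenius norm of the velocity of a Riccati flow decays exponentially if
`Q + P H P` dominates `α P`. -/
lemma sqrt_trace_weighted_le {A Q H : Matrix ι ι ℝ} {P : ℝ → Matrix ι ι ℝ} {α : ℝ}
    (hQ : Qᵀ = Q) (hH : Hᵀ = H) (hpos : ∀ t, 0 ≤ t → (P t).PosDef)
    (hP : ∀ t, 0 ≤ t → HasDerivWithinAt P (riccatiField A Q H (P t)) (Ici 0) t)
    (hdom : ∀ t, 0 ≤ t → (Q + P t * H * P t - α • P t).PosSemidef) {t : ℝ} (ht : 0 ≤ t) :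
    √(trace ((P t)⁻¹ * riccatiField A Q H (P t) * (P t)⁻¹ * riccatiField A Q H (P t))) ≤
      √(trace ((P 0)⁻¹ * riccatiField A Q H (P 0) * (P 0)⁻¹ * riccatiField A Q H (P 0)))
        * Real.exp (-α * t) := by
  set g : ℝ → ℝ := fun u =>
    trace ((P u)⁻¹ * riccatiField A Q H (P u) * (P u)⁻¹ * riccatiField A Q H (P u)) with hg
  set G : ℝ → ℝ := fun u => trace (((P u)⁻¹ * Q * (P u)⁻¹ + H) *
    (riccatiField A Q H (P u) * (P u)⁻¹ * riccatiField A Q H (P u))) with hG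
  have hderiv (u : ℝ) (hu : 0 ≤ u) : HasDerivWithinAt g (-2 * G u) (Ici 0) u := by
    have h1 := hasDerivWithinAt_inv (hP u hu) (hpos u hu).isUnit
    have h2 := hasDerivWithinAt_riccatiField (A := A) (Q := Q) (H := H) (hP u hu)
    have h3 := hasDerivWithinAt_trace (hasDerivWithinAt_matrix_mul
      (hasDerivWithinAt_matrix_mul (hasDerivWithinAt_matrix_mul h1 h2) h1) h2)
    rwa [trace_weighted_deriv (det_isUnit_of_posDef (hpos u hu)) rfl] at h3
  have hle (u : ℝ) (hu : 0 ≤ u) : α * g u ≤ G u := by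
    have hY := riccatiField_transpose (A := A) hQ hH
      (transpose_eq_of_posSemidef (hpos u hu).posSemidef)
    -- `G - α g` is the trace of a product of two positive semidefinite matrices, one of them `Y P⁻¹
    -- Y`.
    have hW := posSemidef_mul_mul_transpose (hpos u hu).inv.posSemidef (riccatiField A Q H (P u))
    rw [hY] at hW
    have h1 := trace_mul_nonneg (posSemidef_inv_conj (hpos u hu) (hdom u hu)) hW
    rw [Matrix.sub_mul, trace_sub, smul_mul, trace_smul, smul_eq_mul] at h1
    simp only [hg, hG]
    simp only [Matrix.mul_assoc] at h1 ⊢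
    linarith
  have hmono : MonotoneOn (fun u => -(Real.exp (2 * α * u) * g u)) (Ici 0) := by
    refine monotoneOn_of_hasDerivWithinAt_Ici (convex_Ici 0) subset_rfl (fun u hu =>
      ((((hasDerivAt_id u).const_mul (2 * α)).exp).hasDerivWithinAt.mul (hderiv u hu)).neg) ?_
    intro u hu
    have := mul_nonneg (Real.exp_pos (2 * α * u)).le (sub_nonneg.2 (hle u hu))
    simp only [id]
    linarith
  have h0 := hmono (mem_Ici.2 le_rfl) ht ht
  simp only [mul_zero, Real.exp_zero, one_mul, neg_le_neg_iff] at h0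
  have he : Real.exp (-α * t) ^ 2 * Real.exp (2 * α * t) = 1 := by
    rw [← Real.exp_nat_mul, ← Real.exp_add, Real.exp_eq_one_iff]
    push_cast
    ring
  have h4 : g t ≤ g 0 * Real.exp (-α * t) ^ 2 := by
    calc g t = (Real.exp (-α * t) ^ 2 * Real.exp (2 * α * t)) * g t := by rw [he, one_mul]
      _ = Real.exp (-α * t) ^ 2 * (Real.exp (2 * α * t) * g t) := by ring
      _ ≤ Real.exp (-α * t) ^ 2 * g 0 := by gcongr
      _ = _ := mul_comm _ _
  calc √(g t) ≤ √(g 0 * Real.exp (-α * t) ^ 2) := Real.sqrt_le_sqrt h4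
    _ = √(g 0) * Real.exp (-α * t) := by
      rw [Real.sqrt_mul' _ (sq_nonneg _), Real.sqrt_sq (Real.exp_pos _).le]

/-- The total relative variation is at most `∫ c exp (-α t) = c / α`. The integrating factors are
`exp (∓(c / α) exp (-α t))`. -/
lemma exp_le_and_le_exp_of_abs_deriv_le {f f' : ℝ → ℝ} {c α : ℝ} (hα : 0 < α) (hc : 0 ≤ c)
    (hf : ∀ t, 0 ≤ t → HasDerivWithinAt f (f' t) (Ici 0) t) (hf0 : ∀ t, 0 ≤ t → 0 ≤ f t)
    (hle : ∀ t, 0 ≤ t → |f' t| ≤ c * Real.exp (-α * t) * f t) {t : ℝ} (ht : 0 ≤ t) :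
    Real.exp (-(c / α)) * f 0 ≤ f t ∧ f t ≤ Real.exp (c / α) * f 0 := by
  have hexp (b u : ℝ) : HasDerivWithinAt (fun u => Real.exp (b * Real.exp (-α * u)))
      (Real.exp (b * Real.exp (-α * u)) * (b * (Real.exp (-α * u) * (-α * 1)))) (Ici 0) u :=
    ((((hasDerivAt_id u).const_mul (-α)).exp.const_mul b).exp).hasDerivWithinAt
  have hE1 : Real.exp (-α * t) ≤ 1 := Real.exp_le_one_iff.2 (by nlinarith)
  have hcα : 0 ≤ c / α := by positivity
  constructor
  · have hmono : MonotoneOn (fun u => Real.exp (-(c / α) * Real.exp (-α * u)) * f u) (Ici 0) := by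
      refine monotoneOn_of_hasDerivWithinAt_Ici (convex_Ici 0) subset_rfl
        (fun u hu => (hexp (-(c / α)) u).mul (hf u hu)) fun u hu => ?_
      have h1 := (abs_le.1 (hle u hu)).1
      have h2 : -(c / α) * (Real.exp (-α * u) * (-α * 1)) = c * Real.exp (-α * u) := by
        field_simp
      rw [h2]
      have := mul_nonneg (Real.exp_pos (-(c / α) * Real.exp (-α * u))).le
        (by linarith : 0 ≤ c * Real.exp (-α * u) * f u + f' u)
      linarith
    have h := hmono (mem_Ici.2 le_rfl) ht ht
    simp only [mul_zero, Real.exp_zero, mul_one] at h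
    refine h.trans (mul_le_of_le_one_left (hf0 t ht) (Real.exp_le_one_iff.2 ?_))
    have := mul_nonneg hcα (Real.exp_pos (-α * t)).le
    linarith
  · have hmono : MonotoneOn (fun u => -(Real.exp (c / α * Real.exp (-α * u)) * f u)) (Ici 0) := by
      refine monotoneOn_of_hasDerivWithinAt_Ici (convex_Ici 0) subset_rfl
        (fun u hu => ((hexp (c / α) u).mul (hf u hu)).neg) fun u hu => ?_
      have h1 := (abs_le.1 (hle u hu)).2
      have h2 : (c / α) * (Real.exp (-α * u) * (-α * 1)) = -(c * Real.exp (-α * u)) := by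
        field_simp
      rw [h2]
      have := mul_nonneg (Real.exp_pos (c / α * Real.exp (-α * u))).le
        (by linarith : 0 ≤ c * Real.exp (-α * u) * f u - f' u)
      linarith
    have h := hmono (mem_Ici.2 le_rfl) ht ht
    simp only [mul_zero, Real.exp_zero, mul_one, neg_le_neg_iff] at h
    refine le_trans (le_mul_of_one_le_left (hf0 t ht) (Real.one_le_exp ?_)) h
    positivity

/-- Subtracting `(K / α) exp (-α t)` adds `K exp (-α t)` to the derivative, which makes it
nonnegative; a bounded monotone function converges. -/
lemma exists_tendsto_of_abs_deriv_le {f f' : ℝ → ℝ} {K α B : ℝ} (hα : 0 < α) (hK : 0 ≤ K)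
    (hf : ∀ t, 0 ≤ t → HasDerivWithinAt f (f' t) (Ici 0) t) (hB : ∀ t, 0 ≤ t → f t ≤ B)
    (hle : ∀ t, 0 ≤ t → |f' t| ≤ K * Real.exp (-α * t)) : ∃ l, Tendsto f atTop (𝓝 l) := by
  have hexp0 : Tendsto (fun t : ℝ => K / α * Real.exp (-α * t)) atTop (𝓝 0) := by
    have h1 : Tendsto (fun t : ℝ => -α * t) atTop atBot :=
      tendsto_id.const_mul_atTop_of_neg (neg_lt_zero.2 hα)
    simpa using (Real.tendsto_exp_atBot.comp h1).const_mul (K / α)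
  have hmono : MonotoneOn (fun u => f u - K / α * Real.exp (-α * u)) (Ici 0) := by
    refine monotoneOn_of_hasDerivWithinAt_Ici (convex_Ici 0) subset_rfl (fun u hu =>
      (hf u hu).sub (((hasDerivAt_id u).const_mul (-α)).exp.const_mul (K / α)).hasDerivWithinAt)
      fun u hu => ?_
    have h1 := (abs_le.1 (hle u hu)).1
    have h2 : K / α * (Real.exp (-α * u) * (-α * 1)) = -(K * Real.exp (-α * u)) := by field_simp
    simp only [id, h2]
    linarith
  have hmono' : Monotone (fun u => f (max u 0) - K / α * Real.exp (-α * max u 0)) :=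
    fun a b hab => hmono (le_max_right a 0) (le_max_right b 0) (max_le_max_right 0 hab)
  have hbdd : BddAbove (range fun u => f (max u 0) - K / α * Real.exp (-α * max u 0)) := by
    refine ⟨B, ?_⟩
    rintro _ ⟨u, rfl⟩
    have h1 := hB (max u 0) (le_max_right _ _)
    have h2 : 0 ≤ K / α * Real.exp (-α * max u 0) := by positivity
    simp only
    linarith
  have hlim := (tendsto_atTop_ciSup hmono' hbdd)
  refine ⟨_, Tendsto.congr' ?_ (hlim.add hexp0)⟩
  filter_upwards [eventually_ge_atTop 0] with u hu
  simp [max_eq_left hu]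

lemma eq_polarization {M : Matrix ι ι ℝ} (hM : Mᵀ = M) (i j : ι) :
    M i j = (((Pi.single i 1 + Pi.single j 1) ⬝ᵥ M *ᵥ (Pi.single i 1 + Pi.single j 1))
      - (Pi.single i 1) ⬝ᵥ M *ᵥ (Pi.single i 1) - (Pi.single j 1) ⬝ᵥ M *ᵥ (Pi.single j 1)) / 2 := by
  have h : M j i = M i j := congrFun (congrFun hM i) j
  simp [mulVec_add, h]
  ring

lemma eq_zero_of_quadratic_eq_zero {M : Matrix ι ι ℝ} (hM : Mᵀ = M)
    (h : ∀ v : ι → ℝ, v ⬝ᵥ M *ᵥ v = 0) : M = 0 := by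
  ext i j
  rw [eq_polarization hM]
  simp only [h]
  simp

/-- A Riccati flow along which `Q + P H P` dominates `α P` converges to a positive definite
equilibrium, at which the domination persists. -/
theorem exists_tendsto_riccati {A Q H : Matrix ι ι ℝ} {P : ℝ → Matrix ι ι ℝ} {α : ℝ} (hα : 0 < α)
    (hQ : Qᵀ = Q) (hH : Hᵀ = H) (hpos : ∀ t, 0 ≤ t → (P t).PosDef)
    (hP : ∀ t, 0 ≤ t → HasDerivWithinAt P (riccatiField A Q H (P t)) (Ici 0) t)
    (hdom : ∀ t, 0 ≤ t → (Q + P t * H * P t - α • P t).PosSemidef) :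
    ∃ L : Matrix ι ι ℝ, L.PosDef ∧ riccatiField A Q H L = 0 ∧ Tendsto P atTop (𝓝 L) ∧
      (Q + L * H * L - α • L).PosSemidef := by
  set c := √(trace ((P 0)⁻¹ * riccatiField A Q H (P 0) * (P 0)⁻¹ * riccatiField A Q H (P 0)))
  have hsym (t : ℝ) (ht : 0 ≤ t) := transpose_eq_of_posSemidef (hpos t ht).posSemidef
  have hder (v : ι → ℝ) (t : ℝ) (ht : 0 ≤ t) := hasDerivWithinAt_quadratic (hP t ht) v
  have hvel (v : ι → ℝ) (t : ℝ) (ht : 0 ≤ t) :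
      |v ⬝ᵥ riccatiField A Q H (P t) *ᵥ v| ≤ c * Real.exp (-α * t) * (v ⬝ᵥ P t *ᵥ v) :=
    (abs_quadratic_le_weighted (hpos t ht) (riccatiField_transpose hQ hH (hsym t ht)) v).trans
      (mul_le_mul_of_nonneg_right (sqrt_trace_weighted_le hQ hH hpos hP hdom ht)
        (quadratic_nonneg (hpos t ht).posSemidef v))
  have hbd (v : ι → ℝ) (t : ℝ) (ht : 0 ≤ t) := exp_le_and_le_exp_of_abs_deriv_le hα
    (Real.sqrt_nonneg _) (hder v) (fun t ht => quadratic_nonneg (hpos t ht).posSemidef v)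
    (hvel v) ht
  have hvel' (v : ι → ℝ) (t : ℝ) (ht : 0 ≤ t) : |v ⬝ᵥ riccatiField A Q H (P t) *ᵥ v| ≤
      c * (Real.exp (c / α) * (v ⬝ᵥ P 0 *ᵥ v)) * Real.exp (-α * t) := by
    refine (hvel v t ht).trans ?_
    have := mul_le_mul_of_nonneg_left (hbd v t ht).2
      (by positivity : 0 ≤ c * Real.exp (-α * t))
    linarith
  have hK (v : ι → ℝ) : 0 ≤ c * (Real.exp (c / α) * (v ⬝ᵥ P 0 *ᵥ v)) :=
    mul_nonneg (Real.sqrt_nonneg _) (mul_nonneg (Real.exp_pos _).le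
      (quadratic_nonneg (hpos 0 le_rfl).posSemidef v))
  have hconv (v : ι → ℝ) : ∃ l, Tendsto (fun t => v ⬝ᵥ P t *ᵥ v) atTop (𝓝 l) :=
    exists_tendsto_of_abs_deriv_le hα (hK v) (hder v) (fun t ht => (hbd v t ht).2) (hvel' v)
  choose q hq using hconv
  -- Only the forms `vᵀ P v` are known to converge; polarization recovers the entries of the limit.
  let L : Matrix ι ι ℝ := Matrix.of fun i j =>
    (q (Pi.single i 1 + Pi.single j 1) - q (Pi.single i 1) - q (Pi.single j 1)) / 2
  have hL : Tendsto P atTop (𝓝 L) := by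
    refine tendsto_pi_nhds.2 fun i => tendsto_pi_nhds.2 fun j => ?_
    refine Tendsto.congr' ?_ ((((hq (Pi.single i 1 + Pi.single j 1)).sub
      (hq (Pi.single i 1))).sub (hq (Pi.single j 1))).div_const 2)
    filter_upwards [eventually_ge_atTop 0] with t ht
    exact (eq_polarization (hsym t ht) i j).symm
  have hLsym : Lᵀ = L := by
    ext i j
    simp only [L, transpose_apply, of_apply, add_comm (Pi.single j 1 : ι → ℝ)]
    ring
  have hlimq {F : Matrix ι ι ℝ → Matrix ι ι ℝ} (hF : Continuous F) (v : ι → ℝ) :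
      Tendsto (fun t => v ⬝ᵥ F (P t) *ᵥ v) atTop (𝓝 (v ⬝ᵥ F L *ᵥ v)) := by
    have : Continuous fun M : Matrix ι ι ℝ => v ⬝ᵥ F M *ᵥ v := by fun_prop
    exact (this.tendsto L).comp hL
  refine ⟨L, posDef_of_quadratic_pos hLsym fun v hv => ?_, ?_, hL, ?_⟩
  · have h1 := quadratic_pos (hpos 0 le_rfl) hv
    refine lt_of_lt_of_le (mul_pos (Real.exp_pos (-(c / α))) h1)
      (ge_of_tendsto (hlimq continuous_id v) ?_)
    filter_upwards [eventually_ge_atTop 0] with t ht using (hbd v t ht).1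
  · refine eq_zero_of_quadratic_eq_zero (riccatiField_transpose hQ hH hLsym) fun v => ?_
    have hc : Continuous (riccatiField A Q H) := by
      unfold riccatiField
      fun_prop
    refine tendsto_nhds_unique (hlimq hc v) ?_
    have h1 : Tendsto (fun t : ℝ => -α * t) atTop atBot :=
      tendsto_id.const_mul_atTop_of_neg (neg_lt_zero.2 hα)
    have h2 := (Real.tendsto_exp_atBot.comp h1).const_mul
      (c * (Real.exp (c / α) * (v ⬝ᵥ P 0 *ᵥ v)))
    rw [mul_zero] at h2
    refine squeeze_zero_norm' ?_ h2
    filter_upwards [eventually_ge_atTop 0] with t ht using hvel' v t ht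
  · refine posSemidef_of_quadratic_nonneg ?_ fun v => ?_
    · simp only [transpose_sub, transpose_add, transpose_mul, transpose_smul, hQ, hH, hLsym,
        Matrix.mul_assoc]
    · have hc : Continuous fun M : Matrix ι ι ℝ => Q + M * H * M - α • M := by fun_prop
      refine ge_of_tendsto (hlimq hc v) ?_
      filter_upwards [eventually_ge_atTop 0] with t ht using quadratic_nonneg (hdom t ht) v

/-- With `a = Sᵀ S` and `b = Tᵀ T` the trace is the squared Frobenius norm of `T Z Sᵀ`. -/
lemma eq_zero_of_trace_weighted_nonpos {a b Z : Matrix ι ι ℝ} (ha : a.PosDef) (hb : b.PosDef)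
    (hZ : Zᵀ = Z) (h : trace (a * (Z * b * Z)) ≤ 0) : Z = 0 := by
  obtain ⟨S, hS, rfl⟩ := exists_isUnit_transpose_mul_self_eq ha
  obtain ⟨T, hT, rfl⟩ := exists_isUnit_transpose_mul_self_eq hb
  have e : trace (Sᵀ * S * (Z * (Tᵀ * T) * Z)) = trace ((T * Z * Sᵀ)ᴴ * (T * Z * Sᵀ)) := by
    rw [Matrix.mul_assoc, trace_mul_comm]
    simp only [conjTranspose_eq_transpose_of_trivial, transpose_mul, transpose_transpose, hZ,
      Matrix.mul_assoc]
  have h0 : T * Z * Sᵀ = 0 := by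
    rw [← trace_conjTranspose_mul_self_eq_zero_iff, ← e]
    refine le_antisymm h ?_
    rw [e]
    exact (posSemidef_conjTranspose_mul_self _).trace_nonneg
  have hS' : IsUnit Sᵀ.det := by rwa [det_transpose]
  calc Z = T⁻¹ * (T * Z * Sᵀ) * (Sᵀ)⁻¹ := by
        rw [Matrix.mul_assoc T, nonsing_inv_mul_cancel_left _ _ hT,
          mul_nonsing_inv_cancel_right _ _ hS']
    _ = 0 := by rw [h0, Matrix.mul_zero, Matrix.zero_mul]

/-- Uniqueness of the positive definite equilibrium of a Riccati equation. -/
theorem riccatiField_eq_zero_unique {A Q H L M : Matrix ι ι ℝ} {α : ℝ} (hα : 0 < α)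
    (hQ : Q.PosSemidef) (hH : H.PosSemidef) (hL : L.PosDef) (hM : M.PosDef)
    (hL0 : riccatiField A Q H L = 0) (hM0 : riccatiField A Q H M = 0)
    (hdom : (Q + L * H * L - α • L).PosSemidef) : M = L := by
  have hLu := det_isUnit_of_posDef hL
  have hMu := det_isUnit_of_posDef hM
  have eL := inv_mul_riccatiField_mul_inv (A := A) (Q := Q) (H := H) hLu
  have eM := inv_mul_riccatiField_mul_inv (A := A) (Q := Q) (H := H) hMu
  rw [hL0, Matrix.mul_zero, Matrix.zero_mul] at eL
  rw [hM0, Matrix.mul_zero, Matrix.zero_mul] at eM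
  have hLs := transpose_eq_of_posSemidef hL.posSemidef
  have hMs := transpose_eq_of_posSemidef hM.posSemidef
  have hLis := transpose_eq_of_posSemidef hL.inv.posSemidef
  have hMis := transpose_eq_of_posSemidef hM.inv.posSemidef
  have hHs := transpose_eq_of_posSemidef hH
  have hLi : L * L⁻¹ = 1 := mul_nonsing_inv _ hLu
  have hMi : M⁻¹ * M = 1 := nonsing_inv_mul _ hMu
  have hdom' := posSemidef_inv_conj hL hdom
  have hap := hM.inv
  have hbp := hL.inv
  set a := M⁻¹
  set b := L⁻¹
  set Z := M - L with hZ
  have hZs : Zᵀ = Z := by rw [hZ, transpose_sub, hLs, hMs]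
  -- The Sylvester equation `(A - M H) Z + Z (Aᵀ - H L) = 0`, from `M H M - L H L = M H Z + Z H L`.
  have hsyl : A * Z - M * H * Z + (Z * Aᵀ - Z * H * L) = 0 := by
    have : riccatiField A Q H M - riccatiField A Q H L = 0 := by rw [hL0, hM0, sub_zero]
    rw [← this, hZ]
    simp only [riccatiField]
    noncomm_ring
  have htr : trace ((a * A - H) * (Z * b * Z)) + trace (a * (Z * (Aᵀ * b - H) * Z)) = 0 := by
    rw [← trace_add]
    have : (a * A - H) * (Z * b * Z) + a * (Z * (Aᵀ * b - H) * Z)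
        = a * (A * Z - M * H * Z + (Z * Aᵀ - Z * H * L)) * b * Z := by
      calc (a * A - H) * (Z * b * Z) + a * (Z * (Aᵀ * b - H) * Z)
          = (a * A - (a * M) * H) * (Z * b * Z) + a * (Z * (Aᵀ * b - H * (L * b)) * Z) := by
            rw [hMi, hLi, Matrix.one_mul, Matrix.mul_one]
        _ = _ := by noncomm_ring
    rw [this, hsyl]
    simp
  -- A trace equals that of the transpose, so `a A` may be symmetrized; the equation of the
  -- equilibrium `M` then eliminates `A`. The next identity does the same with `L`.
  have h1 : 2 * trace ((a * A - H) * (Z * b * Z)) = -trace ((a * Q * a + H) * (Z * b * Z)) := by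
    have e : trace ((a * A - H) * (Z * b * Z)) = trace ((Aᵀ * a - H) * (Z * b * Z)) := by
      rw [← trace_transpose, transpose_mul, trace_mul_comm]
      simp only [transpose_sub, transpose_mul, hHs, hMis, hLis, hZs, Matrix.mul_assoc]
    have e' : (a * A - H) * (Z * b * Z) + (Aᵀ * a - H) * (Z * b * Z)
        = (a * A + Aᵀ * a + a * Q * a - H) * (Z * b * Z) - (a * Q * a + H) * (Z * b * Z) := by
      noncomm_ring
    rw [two_mul]
    nth_rewrite 2 [e]
    rw [← trace_add, e', ← eM, Matrix.zero_mul, zero_sub, trace_neg]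
  have h2 : 2 * trace (a * (Z * (Aᵀ * b - H) * Z)) = -trace (a * (Z * (b * Q * b + H) * Z)) := by
    have e : trace (a * (Z * (Aᵀ * b - H) * Z)) = trace (a * (Z * (b * A - H) * Z)) := by
      rw [← trace_transpose, transpose_mul, trace_mul_comm]
      simp only [transpose_sub, transpose_mul, transpose_transpose, hHs, hMis, hLis, hZs,
        Matrix.mul_assoc]
    have e' : a * (Z * (Aᵀ * b - H) * Z) + a * (Z * (b * A - H) * Z)
        = a * (Z * (b * A + Aᵀ * b + b * Q * b - H) * Z) - a * (Z * (b * Q * b + H) * Z) := by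
      noncomm_ring
    rw [two_mul]
    nth_rewrite 2 [e]
    rw [← trace_add, e', ← eL, Matrix.mul_zero, Matrix.zero_mul, Matrix.mul_zero, zero_sub,
      trace_neg]
  have hconj {N : Matrix ι ι ℝ} (hN : N.PosSemidef) : (Z * N * Z).PosSemidef := by
    simpa only [hZs] using posSemidef_mul_mul_transpose hN Z
  have h3 : 0 ≤ trace ((a * Q * a + H) * (Z * b * Z)) := by
    refine trace_mul_nonneg (PosSemidef.add ?_ hH) (hconj hbp.posSemidef)
    simpa only [hMis] using posSemidef_mul_mul_transpose hQ a
  have h4 : 0 ≤ trace (a * (Z * (b * Q * b + H - α • b) * Z)) :=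
    trace_mul_nonneg hap.posSemidef (hconj hdom')
  have h5 : trace (a * (Z * (b * Q * b + H - α • b) * Z))
      = trace (a * (Z * (b * Q * b + H) * Z)) - α * trace (a * (Z * b * Z)) := by
    simp only [Matrix.mul_sub, Matrix.sub_mul, Matrix.mul_smul, Matrix.smul_mul, trace_sub,
      trace_smul, smul_eq_mul]
  -- By `htr`, `h1` and `h2` the two traces with `Q` and `H` sum to zero. The first is nonnegative
  -- and the second is at least `α tr (a Z b Z)`.
  have h6 : trace (a * (Z * b * Z)) ≤ 0 := by
    by_contra h
    have := mul_pos hα (not_le.1 h)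
    linarith
  exact sub_eq_zero.1 (eq_zero_of_trace_weighted_nonpos hap hbp hZs h6)

end RiccatiConvergence

/-! ### Absolutely continuous functions and differential inequalities -/

section AbsoluteContinuity

lemma absolutelyContinuous_fun_sum {κ : Type*} (s : Finset κ) {f : κ → ℝ → ℝ} {a b : ℝ}
    (h : ∀ i ∈ s, AbsolutelyContinuousOnInterval (f i) a b) :
    AbsolutelyContinuousOnInterval (fun t => ∑ i ∈ s, f i t) a b := by
  classical
  induction s using Finset.induction_on with
  | empty =>
    simpa using (contDiff_const (𝕜 := ℝ) (c := (0 : ℝ))).contDiffOn.absolutelyContinuousOnInterval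
  | insert i s hi ih =>
    simp only [Finset.sum_insert hi]
    exact (h i (Finset.mem_insert_self _ _)).fun_add
      (ih fun j hj => h j (Finset.mem_insert_of_mem hj))

lemma absolutelyContinuous_of_hasDerivWithinAt {f f' : ℝ → ℝ}
    (h : ∀ t, 0 ≤ t → HasDerivWithinAt f (f' t) (Ici 0) t) (hc : ContinuousOn f' (Ici 0))
    {T : ℝ} (hT : 0 ≤ T) : AbsolutelyContinuousOnInterval f 0 T := by
  obtain ⟨K, hK⟩ := isCompact_Icc.exists_bound_of_continuousOn
    (hc.mono Icc_subset_Ici_self : ContinuousOn f' (Icc 0 T))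
  have hL : LipschitzOnWith K.toNNReal f (Icc 0 T) := by
    refine (convex_Icc 0 T).lipschitzOnWith_of_nnnorm_hasDerivWithin_le (f' := f')
      (fun t ht => (h t ht.1).mono Icc_subset_Ici_self) fun t ht => ?_
    rw [← NNReal.coe_le_coe, coe_nnnorm]
    exact (hK t ht).trans (Real.le_coe_toNNReal K)
  rw [← uIcc_of_le hT] at hL
  exact hL.absolutelyContinuousOnInterval

lemma le_of_ae_deriv_nonpos {f : ℝ → ℝ} {a b : ℝ}
    (hf : AbsolutelyContinuousOnInterval f a b) (hab : a ≤ b)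
    (h : ∀ᵐ t, t ∈ Icc a b → ∃ f', HasDerivAt f f' t ∧ f' ≤ 0) : f b ≤ f a := by
  rw [← sub_nonpos, ← hf.integral_deriv_eq_sub, ← neg_nonneg, ← intervalIntegral.integral_neg]
  refine intervalIntegral.integral_nonneg_of_ae_restrict hab ?_
  filter_upwards [ae_restrict_of_ae h, ae_restrict_mem measurableSet_Icc] with t ht hmem
  obtain ⟨f', hd, hle⟩ := ht hmem
  simp [hd.deriv, hle]

lemma absolutelyContinuous_exp_mul (c a b : ℝ) :
    AbsolutelyContinuousOnInterval (fun t => Real.exp (c * t)) a b :=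
  (by fun_prop : ContDiff ℝ 1 fun t => Real.exp (c * t)).contDiffOn.absolutelyContinuousOnInterval

/-- `exp (-c t) u t` is nondecreasing. This keeps `ε`, and then `σ`, positive. -/
lemma SolvesAE.pos_of_mul_le {u g : ℝ → ℝ} {c : ℝ} (hu : SolvesAE u g) (h0 : 0 < u 0)
    (hg : ∀ t, 0 ≤ t → c * u t ≤ g t) {t : ℝ} (ht : 0 ≤ t) : 0 < u t := by
  have hac := ((absolutelyContinuous_exp_mul (-c) 0 t).fun_mul (hu.1 t ht)).fun_neg
  have hle := le_of_ae_deriv_nonpos hac ht (by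
    filter_upwards [hu.2] with s hs hmem
    refine ⟨_, ((((hasDerivAt_id s).const_mul (-c)).exp).mul (hs hmem.1)).neg, ?_⟩
    have := mul_nonneg (Real.exp_pos (-c * s)).le (sub_nonneg.2 (hg s hmem.1))
    simp only [id]
    linarith)
  simp only [mul_zero, Real.exp_zero, one_mul, neg_le_neg_iff] at hle
  exact (pos_iff_pos_of_mul_pos (h0.trans_le hle)).1 (Real.exp_pos _)

/-- Grönwall's inequality for the dissipation inequality `V' ≤ -α V + b`. -/
lemma le_of_ae_dissipation {V : ℝ → ℝ} {α b : ℝ} (hα : 0 < α)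
    (hV : ∀ T, 0 ≤ T → AbsolutelyContinuousOnInterval V 0 T) {T : ℝ} (hT : 0 ≤ T)
    (h : ∀ᵐ t, T ≤ t → ∃ V', HasDerivAt V V' t ∧ V' ≤ -α * V t + b) {t : ℝ} (ht : T ≤ t) :
    V t ≤ Real.exp (-α * (t - T)) * V T + 1 / α * (1 - Real.exp (-α * (t - T))) * b := by
  have hVac : AbsolutelyContinuousOnInterval V T t :=
    (hV t (hT.trans ht)).mono (by
      rw [uIcc_of_le ht, uIcc_of_le (hT.trans ht)]
      exact Icc_subset_Icc_left hT)
  have hcac : AbsolutelyContinuousOnInterval (fun _ : ℝ => b / α) T t :=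
    (contDiff_const (𝕜 := ℝ)).contDiffOn.absolutelyContinuousOnInterval
  -- `exp (α t) (V t - b / α)` is nonincreasing.
  have hle := le_of_ae_deriv_nonpos
    ((absolutelyContinuous_exp_mul α T t).fun_mul (hVac.fun_sub hcac)) ht (by
      filter_upwards [h] with s hs hmem
      obtain ⟨V', hd, hle⟩ := hs hmem.1
      refine ⟨_, (((hasDerivAt_id s).const_mul α).exp).mul (hd.sub_const (b / α)), ?_⟩
      have h1 : α * (V s - b / α) + V' ≤ 0 := by
        have : α * (b / α) = b := by field_simp
        linarith
      have := mul_nonpos_of_nonneg_of_nonpos (Real.exp_pos (α * s)).le h1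
      simp only [id]
      linarith)
  have he : Real.exp (-α * (t - T)) = Real.exp (-(α * t)) * Real.exp (α * T) := by
    rw [← Real.exp_add]
    ring_nf
  have he' : Real.exp (-(α * t)) * Real.exp (α * t) = 1 := by
    rw [← Real.exp_add]
    simp
  have h2 := mul_le_mul_of_nonneg_left hle (Real.exp_pos (-(α * t))).le
  rw [← mul_assoc, ← mul_assoc, he', one_mul, ← he] at h2
  have h3 : 1 / α * (1 - Real.exp (-α * (t - T))) * b
      = b / α - Real.exp (-α * (t - T)) * (b / α) := by ring
  rw [h3]
  linarith

end AbsoluteContinuity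

/-! ### Extreme eigenvalues and Rayleigh bounds -/

section Rayleigh

variable {k : ℕ} {M : Matrix (Fin k) (Fin k) ℝ}

lemma finite_spectrum (hM : M.IsHermitian) : (spectrum ℝ M).Finite := by
  rw [hM.spectrum_real_eq_range_eigenvalues]
  exact finite_range _

lemma quadratic_le_lamMax (hM : M.IsHermitian) (v : Fin k → ℝ) :
    v ⬝ᵥ M *ᵥ v ≤ lamMax M * (v ⬝ᵥ v) := by
  have hpsd : (algebraMap ℝ _ (lamMax M) - M).PosSemidef := by
    refine posSemidef_iff_isHermitian_and_spectrum_nonneg.2 ⟨?_, ?_⟩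
    · rw [Algebra.algebraMap_eq_smul_one]
      exact (isHermitian_one.smul (IsSelfAdjoint.all _)).sub hM
    · rw [← spectrum.singleton_sub_eq]
      rintro _ ⟨a, rfl, x, hx, rfl⟩
      exact sub_nonneg.2 (le_csSup (finite_spectrum hM).bddAbove hx)
  have h := quadratic_nonneg hpsd v
  rw [Algebra.algebraMap_eq_smul_one, sub_mulVec, smul_mulVec, one_mulVec, dotProduct_sub,
    dotProduct_smul, smul_eq_mul] at h
  linarith

lemma lamMin_mul_le_quadratic (hM : M.IsHermitian) (v : Fin k → ℝ) :
    lamMin M * (v ⬝ᵥ v) ≤ v ⬝ᵥ M *ᵥ v := by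
  have hpsd : (M - algebraMap ℝ _ (lamMin M)).PosSemidef := by
    refine posSemidef_iff_isHermitian_and_spectrum_nonneg.2 ⟨?_, ?_⟩
    · rw [Algebra.algebraMap_eq_smul_one]
      exact hM.sub (isHermitian_one.smul (IsSelfAdjoint.all _))
    · rw [← spectrum.sub_singleton_eq]
      rintro _ ⟨x, hx, a, rfl, rfl⟩
      exact sub_nonneg.2 (csInf_le (finite_spectrum hM).bddBelow hx)
  have h := quadratic_nonneg hpsd v
  rw [Algebra.algebraMap_eq_smul_one, sub_mulVec, smul_mulVec, one_mulVec, dotProduct_sub,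
    dotProduct_smul, smul_eq_mul] at h
  linarith

lemma lamMin_pos [NeZero k] (hM : M.PosDef) : 0 < lamMin M := by
  have hs := hM.isHermitian.spectrum_real_eq_range_eigenvalues
  have hmem : lamMin M ∈ spectrum ℝ M :=
    (hs ▸ range_nonempty _ : (spectrum ℝ M).Nonempty).csInf_mem (finite_spectrum hM.isHermitian)
  rw [hs] at hmem
  obtain ⟨i, hi⟩ := hmem
  rw [← hi]
  exact hM.eigenvalues_pos i

/-- This includes `k = 0`, where the spectrum is empty and its `sSup` is `0`. -/
lemma lamMax_nonneg (hM : M.PosSemidef) : 0 ≤ lamMax M :=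
  Real.sSup_nonneg fun x hx => by
    simpa using (posSemidef_iff_isHermitian_and_spectrum_nonneg.1 hM).2 hx

lemma norm_sq_eq_dotProduct (v : EuclideanSpace ℝ (Fin k)) : ‖v‖ ^ 2 = v.ofLp ⬝ᵥ v.ofLp := by
  rw [EuclideanSpace.real_norm_sq_eq]
  simp [dotProduct, sq]

end Rayleigh

/-! ### The pointwise dissipation inequality -/

section Dissipation

variable {n p m : ℕ}

/-- The sector condition: the saturated value lies between `0` and `r`. -/
lemma sat_mul_sub_nonpos {b : ℝ} (hb : 0 ≤ b) (r : ℝ) : (sat b r - r) * sat b r ≤ 0 := by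
  unfold sat
  rcases le_total b r with h | h
  · rw [min_eq_left h, max_eq_right (by linarith)]
    nlinarith
  · rw [min_eq_right h]
    rcases le_total (-b) r with h' | h'
    · simp [max_eq_right h']
    · rw [max_eq_left h']
      nlinarith

/-- The value at `(e, ψ, d)` of the quadratic form of the block matrix. -/
lemma blockS_quadratic (C : Matrix (Fin p) (Fin n) ℝ) (D : Matrix (Fin p) (Fin m) ℝ)
    (Q : Matrix (Fin n) (Fin n) ℝ) (R : Matrix (Fin p) (Fin p) ℝ) (gam2 w : Fin p → ℝ)
    (U : Matrix (Fin m) (Fin m) ℝ) (α : ℝ) (P : Matrix (Fin n) (Fin n) ℝ)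
    (e : Fin n → ℝ) (ψ : Fin p → ℝ) (d : Fin m → ℝ) :
    Sum.elim e (Sum.elim ψ d) ⬝ᵥ blockS C D Q R gam2 w U α P *ᵥ Sum.elim e (Sum.elim ψ d)
      = e ⬝ᵥ (P⁻¹ * Q * P⁻¹) *ᵥ e + (C *ᵥ e) ⬝ᵥ R⁻¹ *ᵥ (C *ᵥ e)
        - (C *ᵥ e) ⬝ᵥ diagonal gam2 *ᵥ (C *ᵥ e) - α * (e ⬝ᵥ P⁻¹ *ᵥ e)
        - 2 * ((C *ᵥ e) ⬝ᵥ R⁻¹ *ᵥ ψ) - 2 * ((C *ᵥ e) ⬝ᵥ diagonal w *ᵥ ψ)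
        + 2 * ((C *ᵥ e) ⬝ᵥ diagonal gam2 *ᵥ (D *ᵥ d)) - 2 * ((C *ᵥ e) ⬝ᵥ R⁻¹ *ᵥ (D *ᵥ d))
        + 2 * (ψ ⬝ᵥ diagonal w *ᵥ ψ) + 2 * (ψ ⬝ᵥ diagonal w *ᵥ (D *ᵥ d)) + d ⬝ᵥ U *ᵥ d := by
  have hCt (x : Fin n → ℝ) (y : Fin p → ℝ) : x ⬝ᵥ Cᵀ *ᵥ y = (C *ᵥ x) ⬝ᵥ y := by
    rw [dotProduct_mulVec, vecMul_transpose]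
  have htr {q r : ℕ} (N : Matrix (Fin q) (Fin r) ℝ) (x : Fin r → ℝ) (y : Fin q → ℝ) :
      x ⬝ᵥ Nᵀ *ᵥ y = y ⬝ᵥ N *ᵥ x := by
    rw [dotProduct_mulVec, vecMul_transpose, dotProduct_comm]
  simp only [blockS, fromBlocks_mulVec, Sum.elim_comp_inl, Sum.elim_comp_inr,
    sumElim_dotProduct_sumElim, transpose_fromCols, fromCols_mulVec_sumElim, fromRows_mulVec,
    dotProduct_add, htr]
  simp only [neg_mulVec, sub_mulVec, add_mulVec, ← mulVec_mulVec, smul_mulVec, dotProduct_smul,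
    dotProduct_neg, dotProduct_add, dotProduct_sub, hCt, smul_eq_mul, Matrix.mul_add,
    Matrix.sub_mul, Matrix.mul_sub, Matrix.mul_assoc]
  ring

/-- The derivative of `eᵀ P⁻¹ e` along `e' = A e + P Cᵀ R⁻¹ s` and the Riccati flow of `P`. -/
lemma quadratic_inv_deriv {A Q P : Matrix (Fin n) (Fin n) ℝ} {C : Matrix (Fin p) (Fin n) ℝ}
    {R : Matrix (Fin p) (Fin p) ℝ} (hP : P.PosDef)
    (e : Fin n → ℝ) (s : Fin p → ℝ) :
    (A *ᵥ e + (P * Cᵀ * R⁻¹) *ᵥ s) ⬝ᵥ P⁻¹ *ᵥ e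
      + e ⬝ᵥ (-(P⁻¹ * riccatiField A Q (Cᵀ * R⁻¹ * C) P * P⁻¹)) *ᵥ e
      + e ⬝ᵥ P⁻¹ *ᵥ (A *ᵥ e + (P * Cᵀ * R⁻¹) *ᵥ s)
      = -(e ⬝ᵥ (P⁻¹ * Q * P⁻¹) *ᵥ e) + (C *ᵥ e) ⬝ᵥ R⁻¹ *ᵥ (C *ᵥ e)
        + 2 * ((C *ᵥ e) ⬝ᵥ R⁻¹ *ᵥ s) := by
  have hCt (x : Fin n → ℝ) (y : Fin p → ℝ) : x ⬝ᵥ Cᵀ *ᵥ y = (C *ᵥ x) ⬝ᵥ y := by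
    rw [dotProduct_mulVec, vecMul_transpose]
  have hPs := transpose_eq_of_posSemidef hP.inv.posSemidef
  have hPi : P⁻¹ * P = 1 := nonsing_inv_mul _ (det_isUnit_of_posDef hP)
  have h1 : P⁻¹ *ᵥ ((P * Cᵀ * R⁻¹) *ᵥ s) = Cᵀ *ᵥ R⁻¹ *ᵥ s := by
    rw [mulVec_mulVec, Matrix.mul_assoc, ← Matrix.mul_assoc P⁻¹, hPi, Matrix.one_mul,
      mulVec_mulVec]
  have h2 (x : Fin n → ℝ) : x ⬝ᵥ P⁻¹ *ᵥ e = e ⬝ᵥ P⁻¹ *ᵥ x :=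
    dotProduct_mulVec_comm_of_transpose_eq hPs x e
  have h3 : e ⬝ᵥ Aᵀ *ᵥ (P⁻¹ *ᵥ e) = e ⬝ᵥ P⁻¹ *ᵥ (A *ᵥ e) := by
    rw [dotProduct_mulVec, vecMul_transpose, h2]
  rw [h2, inv_mul_riccatiField_mul_inv (det_isUnit_of_posDef hP), mulVec_add, h1]
  simp only [neg_mulVec, sub_mulVec, add_mulVec, ← mulVec_mulVec, dotProduct_neg, dotProduct_add,
    dotProduct_sub, hCt, h3]
  ring

/-- The pointwise dissipation inequality for `V = eᵀ P⁻¹ e + ∑ σ_i + ∑ ε_i`. -/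
lemma lyapunov_deriv_le {A Q P : Matrix (Fin n) (Fin n) ℝ} {C : Matrix (Fin p) (Fin n) ℝ}
    {D : Matrix (Fin p) (Fin m) ℝ} {R : Matrix (Fin p) (Fin p) ℝ} {U : Matrix (Fin m) (Fin m) ℝ}
    {lam1 lam2 gam1 gam2 w : Fin p → ℝ} {α : ℝ} (hP : P.PosDef)
    (hw : ∀ i, 0 < w i) (hgam1 : ∀ i, 0 < gam1 i)
    (hα1 : ∀ i, α ≤ -lam1 i) (hα2 : ∀ i, α ≤ -(lam2 i + gam1 i))
    (hS : (blockS C D Q R gam2 w U α P).PosSemidef)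
    (e : Fin n → ℝ) (d : Fin m → ℝ) (σ ε r s : Fin p → ℝ) (hσ : ∀ i, 0 ≤ σ i)
    (hε : ∀ i, 0 ≤ ε i) (hr : r = D *ᵥ d - C *ᵥ e) (hs : ∀ i, (s i - r i) * s i ≤ 0) :
    ((A *ᵥ e + (P * Cᵀ * R⁻¹) *ᵥ s) ⬝ᵥ P⁻¹ *ᵥ e
      + e ⬝ᵥ (-(P⁻¹ * riccatiField A Q (Cᵀ * R⁻¹ * C) P * P⁻¹)) *ᵥ e
      + e ⬝ᵥ P⁻¹ *ᵥ (A *ᵥ e + (P * Cᵀ * R⁻¹) *ᵥ s))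
      + ∑ i, (lam1 i * σ i + gam1 i * (ε i * Real.exp (-(ε i))))
      + ∑ i, (lam2 i * ε i + gam2 i * r i ^ 2)
    ≤ -α * (e ⬝ᵥ P⁻¹ *ᵥ e + ∑ i, σ i + ∑ i, ε i)
      + d ⬝ᵥ (U + Dᵀ * diagonal gam2 * D) *ᵥ d := by
  have hform := quadratic_nonneg hS (Sum.elim e (Sum.elim (s - r) d))
  rw [blockS_quadratic] at hform
  rw [quadratic_inv_deriv hP]
  have hdD : d ⬝ᵥ (Dᵀ * diagonal gam2 * D) *ᵥ d = (D *ᵥ d) ⬝ᵥ diagonal gam2 *ᵥ (D *ᵥ d) := by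
    rw [Matrix.mul_assoc, ← mulVec_mulVec, dotProduct_mulVec, vecMul_transpose, mulVec_mulVec]
  rw [add_mulVec, dotProduct_add, hdD]
  set y := C *ᵥ e
  set δ := D *ᵥ d
  have hsplit : y ⬝ᵥ R⁻¹ *ᵥ s = y ⬝ᵥ R⁻¹ *ᵥ (s - r) + y ⬝ᵥ R⁻¹ *ᵥ δ - y ⬝ᵥ R⁻¹ *ᵥ y := by
    rw [← dotProduct_add, ← dotProduct_sub, ← mulVec_add, ← mulVec_sub, hr]
    congr 2
    abel
  have hdiag (g u v : Fin p → ℝ) : u ⬝ᵥ diagonal g *ᵥ v = ∑ i, g i * (u i * v i) := by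
    simp only [dotProduct, mulVec_diagonal]
    exact Finset.sum_congr rfl fun i _ => by ring
  -- Since `r = δ - y`, the sum is `2 ∑ w_i (s_i - r_i) s_i`.
  have hsat : -2 * ∑ i, w i * (y i * (s - r) i) + 2 * ∑ i, w i * ((s - r) i * (s - r) i)
      + 2 * ∑ i, w i * ((s - r) i * δ i) ≤ 0 := by
    rw [Finset.mul_sum, Finset.mul_sum, Finset.mul_sum, ← Finset.sum_add_distrib,
      ← Finset.sum_add_distrib]
    refine Finset.sum_nonpos fun i _ => ?_
    have h1 : r i = δ i - y i := by rw [hr]; rfl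
    have h2 := mul_nonpos_of_nonneg_of_nonpos (hw i).le (hs i)
    have h3 : δ i = r i + y i := by linarith
    simp only [Pi.sub_apply, h3]
    nlinarith
  -- `ε exp (-ε) ≤ ε` moves the drive of `σ` into the decay of `ε`, at the cost `gam1`. Expanding
  -- `gam2 r²` leaves the term in `δ` that adds `Dᵀ Γ₂ D` to `U`.
  have htrack : ∑ i, (lam1 i * σ i + gam1 i * (ε i * Real.exp (-(ε i))))
      + ∑ i, (lam2 i * ε i + gam2 i * r i ^ 2)
      ≤ -α * (∑ i, σ i + ∑ i, ε i) + (∑ i, gam2 i * (y i * y i)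
        - 2 * ∑ i, gam2 i * (y i * δ i) + ∑ i, gam2 i * (δ i * δ i)) := by
    rw [mul_add, Finset.mul_sum, Finset.mul_sum, Finset.mul_sum, ← Finset.sum_add_distrib,
      ← Finset.sum_add_distrib, ← Finset.sum_sub_distrib, ← Finset.sum_add_distrib,
      ← Finset.sum_add_distrib]
    refine Finset.sum_le_sum fun i _ => ?_
    have h1 : r i = δ i - y i := by rw [hr]; rfl
    have h2 : ε i * Real.exp (-(ε i)) ≤ ε i :=
      mul_le_of_le_one_right (hε i) (Real.exp_le_one_iff.2 (by linarith [hε i]))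
    have h3 := mul_le_mul_of_nonneg_left h2 (hgam1 i).le
    have h4 := mul_le_mul_of_nonneg_right (hα1 i) (hσ i)
    have h5 := mul_le_mul_of_nonneg_right (hα2 i) (hε i)
    rw [h1]
    nlinarith
  simp only [hdiag] at hform ⊢
  linarith

end Dissipation

/-! ### The filter: Riccati solution, domination and decay of the Lyapunov function -/

section SaturatedFilter

variable {n p m : ℕ}

/-- The last factor stays `Pᵀ`: symmetry of the flow is deduced from this form. -/
lemma riccati_eq {A Q : Matrix (Fin n) (Fin n) ℝ} {C : Matrix (Fin p) (Fin n) ℝ}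
    {R : Matrix (Fin p) (Fin p) ℝ} (hR : R.PosDef) (P : Matrix (Fin n) (Fin n) ℝ) :
    riccati A C Q R P = A * P + P * Aᵀ + Q - P * (Cᵀ * R⁻¹ * C) * Pᵀ := by
  have h1 : R⁻¹ * R = 1 := nonsing_inv_mul _ (det_isUnit_of_posDef hR)
  have h2 := transpose_eq_of_posSemidef hR.inv.posSemidef
  have h3 : (P * Cᵀ * R⁻¹) * R * (P * Cᵀ * R⁻¹)ᵀ = P * (Cᵀ * R⁻¹ * C) * Pᵀ := by
    rw [transpose_mul, transpose_mul, h2, transpose_transpose, Matrix.mul_assoc (P * Cᵀ), h1,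
      Matrix.mul_one]
    simp only [Matrix.mul_assoc]
  rw [riccati, h3]

lemma riccati_eq_riccatiField {A Q : Matrix (Fin n) (Fin n) ℝ} {C : Matrix (Fin p) (Fin n) ℝ}
    {R : Matrix (Fin p) (Fin p) ℝ} (hR : R.PosDef) {P : Matrix (Fin n) (Fin n) ℝ} (hP : Pᵀ = P) :
    riccati A C Q R P = riccatiField A Q (Cᵀ * R⁻¹ * C) P := by
  rw [riccati_eq hR, hP, riccatiField]

lemma IsRiccatiSolution.posDef_and_hasDerivWithinAt {A Q : Matrix (Fin n) (Fin n) ℝ}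
    {C : Matrix (Fin p) (Fin n) ℝ} {R : Matrix (Fin p) (Fin p) ℝ} (hQ : Q.PosSemidef)
    (hR : R.PosDef) {P : ℝ → Matrix (Fin n) (Fin n) ℝ} (hP0 : (P 0).PosDef)
    (hP : IsRiccatiSolution A C Q R P) {t : ℝ} (ht : 0 ≤ t) : (P t).PosDef ∧
      HasDerivWithinAt P (riccatiField A Q (Cᵀ * R⁻¹ * C) (P t)) (Ici 0) t := by
  have hH : (Cᵀ * R⁻¹ * C).PosSemidef := posSemidef_transpose_mul_mul hR.inv.posSemidef C
  have hd (u : ℝ) (hu : 0 ≤ u) : HasDerivWithinAt P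
      (A * P u + P u * Aᵀ + Q - P u * (Cᵀ * R⁻¹ * C) * (P u)ᵀ) (Ici 0) u :=
    hasDerivWithinAt_matrix_congr (hasDerivWithinAt_matrix (hP u hu)) (riccati_eq hR _)
  have hsym (u : ℝ) (hu : 0 ≤ u) : (P u)ᵀ = P u :=
    transpose_eq_of_riccati (transpose_eq_of_posSemidef hQ) (transpose_eq_of_posSemidef hH)
      (transpose_eq_of_posSemidef hP0.posSemidef) hd hu
  have hd' (u : ℝ) (hu : 0 ≤ u) : HasDerivWithinAt P
      (A * P u + P u * Aᵀ + Q - P u * (Cᵀ * R⁻¹ * C) * P u) (Ici 0) u :=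
    hasDerivWithinAt_matrix_congr (hd u hu) (by rw [hsym u hu])
  exact ⟨posDef_of_riccati hQ hH hP0 hsym hd' ht, hd' t ht⟩

/-- Positivity of the block matrix makes `Q + P H P` dominate `α P`. -/
lemma dominates_of_blockS {Q P : Matrix (Fin n) (Fin n) ℝ} {C : Matrix (Fin p) (Fin n) ℝ}
    {D : Matrix (Fin p) (Fin m) ℝ} {R : Matrix (Fin p) (Fin p) ℝ} {U : Matrix (Fin m) (Fin m) ℝ}
    {gam2 w : Fin p → ℝ} {α : ℝ} (hQ : Q.PosSemidef) (hR : R.PosDef) (hP : P.PosDef)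
    (hgam2 : ∀ i, 0 < gam2 i) (hS : (blockS C D Q R gam2 w U α P).PosSemidef) :
    (Q + P * (Cᵀ * R⁻¹ * C) * P - α • P).PosSemidef := by
  have hPs := transpose_eq_of_posSemidef hP.posSemidef
  have hRs := transpose_eq_of_posSemidef hR.inv.posSemidef
  refine posSemidef_of_quadratic_nonneg ?_ fun v => ?_
  · simp only [transpose_sub, transpose_add, transpose_mul, transpose_smul, transpose_transpose,
      transpose_eq_of_posSemidef hQ, hPs, hRs, Matrix.mul_assoc]
  have h := quadratic_nonneg hS (Sum.elim (P *ᵥ v) (Sum.elim 0 0))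
  rw [blockS_quadratic] at h
  -- The term in `Γ₂` enters the block with a minus sign, so dropping it keeps the inequality.
  have hΓ := quadratic_nonneg (PosSemidef.diagonal (d := gam2) fun i => (hgam2 i).le)
    (C *ᵥ (P *ᵥ v))
  have hPi : P⁻¹ *ᵥ (P *ᵥ v) = v := by
    rw [mulVec_mulVec, nonsing_inv_mul _ (det_isUnit_of_posDef hP), one_mulVec]
  have hPt (y : Fin n → ℝ) : (P *ᵥ v) ⬝ᵥ y = v ⬝ᵥ P *ᵥ y := by
    conv_rhs => rw [dotProduct_mulVec, ← hPs, vecMul_transpose]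
  have e1 : (P *ᵥ v) ⬝ᵥ (P⁻¹ * Q * P⁻¹) *ᵥ (P *ᵥ v) = v ⬝ᵥ Q *ᵥ v := by
    rw [← mulVec_mulVec, hPi, ← mulVec_mulVec, hPt, mulVec_mulVec v,
      mulVec_mulVec, ← Matrix.mul_assoc, mul_nonsing_inv _ (det_isUnit_of_posDef hP),
      Matrix.one_mul]
  have e2 : v ⬝ᵥ (P * (Cᵀ * R⁻¹ * C) * P) *ᵥ v
      = (C *ᵥ (P *ᵥ v)) ⬝ᵥ R⁻¹ *ᵥ (C *ᵥ (P *ᵥ v)) := by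
    simp only [← mulVec_mulVec]
    rw [← hPt, dotProduct_mulVec _ Cᵀ, vecMul_transpose]
  rw [sub_mulVec, add_mulVec, smul_mulVec, dotProduct_sub, dotProduct_add, dotProduct_smul,
    smul_eq_mul, e2]
  rw [e1, hPi, hPt] at h
  simp only [mulVec_zero, dotProduct_zero, mul_zero, sub_zero, add_zero] at h
  linarith

lemma hasDerivAt_quadratic_moving {M : ℝ → Matrix (Fin n) (Fin n) ℝ} {e : ℝ → Fin n → ℝ}
    {M' : Matrix (Fin n) (Fin n) ℝ} {e' : Fin n → ℝ} {t : ℝ}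
    (hM : ∀ i j, HasDerivAt (fun u => M u i j) (M' i j) t)
    (he : ∀ i, HasDerivAt (fun u => e u i) (e' i) t) :
    HasDerivAt (fun u => e u ⬝ᵥ M u *ᵥ e u)
      (e' ⬝ᵥ M t *ᵥ e t + e t ⬝ᵥ M' *ᵥ e t + e t ⬝ᵥ M t *ᵥ e') t := by
  have h := HasDerivAt.fun_sum (u := Finset.univ) fun i _ => (he i).fun_mul
    (HasDerivAt.fun_sum (u := Finset.univ) fun j _ => (hM i j).fun_mul (he j))
  refine h.congr_deriv ?_
  simp only [dotProduct, mulVec, Finset.sum_add_distrib, mul_add, add_assoc]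

section Trajectory

variable {A Q : Matrix (Fin n) (Fin n) ℝ} {C : Matrix (Fin p) (Fin n) ℝ}
  {D : Matrix (Fin p) (Fin m) ℝ} {R : Matrix (Fin p) (Fin p) ℝ} {U : Matrix (Fin m) (Fin m) ℝ}
  {lam1 lam2 gam1 gam2 w : Fin p → ℝ} {d : ℝ → EuclideanSpace ℝ (Fin m)} {α : ℝ}
  {P : ℝ → Matrix (Fin n) (Fin n) ℝ} {x xhat : ℝ → EuclideanSpace ℝ (Fin n)}
  {σ ε : ℝ → Fin p → ℝ}

lemma IsTrajectory.tracker_pos' (h : IsTrajectory A C D R lam1 lam2 gam1 gam2 d P x xhat σ ε)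
    (hgam2 : ∀ i, 0 < gam2 i) {t : ℝ} (ht : 0 ≤ t) (i : Fin p) : 0 < ε t i :=
  (h.tracker i).pos_of_mul_le (c := lam2 i) (h.tracker_pos i)
    (fun _ _ => le_add_of_nonneg_right (mul_nonneg (hgam2 i).le (sq_nonneg _))) ht

lemma IsTrajectory.bound_pos' (h : IsTrajectory A C D R lam1 lam2 gam1 gam2 d P x xhat σ ε)
    (hgam1 : ∀ i, 0 < gam1 i) (hgam2 : ∀ i, 0 < gam2 i) {t : ℝ} (ht : 0 ≤ t) (i : Fin p) :
    0 < σ t i :=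
  (h.bound i).pos_of_mul_le (c := lam1 i) (h.bound_pos i)
    (fun _ hs => le_add_of_nonneg_right (mul_nonneg (hgam1 i).le
      (mul_nonneg (h.tracker_pos' hgam2 hs i).le (Real.exp_pos _).le))) ht

lemma IsTrajectory.absolutelyContinuous_lyapunov
    (h : IsTrajectory A C D R lam1 lam2 gam1 gam2 d P x xhat σ ε)
    (hpos : ∀ t, 0 ≤ t → (P t).PosDef)
    (hP : ∀ t, 0 ≤ t → HasDerivWithinAt P (riccatiField A Q (Cᵀ * R⁻¹ * C) (P t)) (Ici 0) t)
    {T : ℝ} (hT : 0 ≤ T) :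
    AbsolutelyContinuousOnInterval (fun t => lyapunov (P t) (xhat t - x t) (σ t) (ε t)) 0 T := by
  have hinv (t : ℝ) (ht : 0 ≤ t) := hasDerivWithinAt_inv (hP t ht) (hpos t ht).isUnit
  have hPc : ContinuousOn P (Ici 0) := fun t ht =>
    continuousWithinAt_of_hasDerivWithinAt_matrix (hP t ht)
  have hinvc : ContinuousOn (fun t => (P t)⁻¹) (Ici 0) := fun t ht =>
    continuousWithinAt_of_hasDerivWithinAt_matrix (hinv t ht)
  have hderc : ContinuousOn (fun t =>
      -((P t)⁻¹ * riccatiField A Q (Cᵀ * R⁻¹ * C) (P t) * (P t)⁻¹)) (Ici 0) := by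
    unfold riccatiField
    fun_prop
  have hPinv (i j : Fin n) : AbsolutelyContinuousOnInterval (fun t => (P t)⁻¹ i j) 0 T :=
    absolutelyContinuous_of_hasDerivWithinAt (fun t ht => hasDerivWithinAt_entry (hinv t ht) i j)
      (fun t ht => continuousWithinAt_pi.1 (continuousWithinAt_pi.1 (hderc t ht) i) j) hT
  have hxc (i : Fin n) : ContinuousOn (fun t => x t i) (Ici 0) :=
    fun t ht => (h.plant t ht i).continuousWithinAt
  have hx (i : Fin n) : AbsolutelyContinuousOnInterval (fun t => x t i) 0 T := by
    refine absolutelyContinuous_of_hasDerivWithinAt (fun t ht => h.plant t ht i) ?_ hT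
    simp only [mulVec, dotProduct]
    fun_prop
  have he (i : Fin n) : AbsolutelyContinuousOnInterval (fun t => xhat t i - x t i) 0 T :=
    ((h.estimate i).1 T hT).fun_sub (hx i)
  simp only [lyapunov, dotProduct, mulVec, WithLp.ofLp_sub, Pi.sub_apply]
  refine AbsolutelyContinuousOnInterval.fun_add (AbsolutelyContinuousOnInterval.fun_add ?_
    (absolutelyContinuous_fun_sum _ fun i _ => (h.bound i).1 T hT))
    (absolutelyContinuous_fun_sum _ fun i _ => (h.tracker i).1 T hT)
  exact absolutelyContinuous_fun_sum _ fun i _ => (he i).fun_mul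
    (absolutelyContinuous_fun_sum _ fun j _ => (hPinv i j).fun_mul (he j))

lemma IsTrajectory.ae_lyapunov_deriv_le
    (h : IsTrajectory A C D R lam1 lam2 gam1 gam2 d P x xhat σ ε)
    (hpos : ∀ t, 0 ≤ t → (P t).PosDef)
    (hP : ∀ t, 0 ≤ t → HasDerivWithinAt P (riccatiField A Q (Cᵀ * R⁻¹ * C) (P t)) (Ici 0) t)
    (hgam1 : ∀ i, 0 < gam1 i) (hgam2 : ∀ i, 0 < gam2 i) (hw : ∀ i, 0 < w i) (hU : U.PosDef)
    (hα1 : ∀ i, α ≤ -lam1 i) (hα2 : ∀ i, α ≤ -(lam2 i + gam1 i))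
    (hS : ∀ t, 0 ≤ t → (blockS C D Q R gam2 w U α (P t)).PosSemidef) :
    ∀ᵐ t, 0 ≤ t → ∃ V',
      HasDerivAt (fun t => lyapunov (P t) (xhat t - x t) (σ t) (ε t)) V' t ∧
      V' ≤ -α * lyapunov (P t) (xhat t - x t) (σ t) (ε t)
        + lamMax (U + Dᵀ * diagonal gam2 * D) * ‖d t‖ ^ 2 := by
  have hest := ae_all_iff.2 fun i => (h.estimate i).2
  have hbnd := ae_all_iff.2 fun i => (h.bound i).2
  have htrk := ae_all_iff.2 fun i => (h.tracker i).2
  -- Time `0` is excluded because `P` and `x` are only assumed to have one-sided derivatives there.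
  filter_upwards [hest, hbnd, htrk, compl_mem_ae_iff.2 (measure_singleton (0 : ℝ))]
    with t h1 h2 h3 hne ht
  have ht' : 0 < t := lt_of_le_of_ne ht fun h => hne h.symm
  have hnhds : Ici (0 : ℝ) ∈ 𝓝 t := Ici_mem_nhds ht'
  have hinv := hasDerivWithinAt_inv (hP t ht) (hpos t ht).isUnit
  set r := innovation C D d x xhat t with hr
  set s : Fin p → ℝ := fun j => sat (Real.sqrt (σ t j)) (r j) with hs
  set e : Fin n → ℝ := (xhat t - x t).ofLp with he
  have hederiv (i : Fin n) : HasDerivAt (fun u => (xhat u - x u).ofLp i)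
      ((A *ᵥ e + (P t * Cᵀ * R⁻¹) *ᵥ s) i) t := by
    refine ((h1 i ht).sub ((h.plant t ht i).hasDerivAt hnhds)).congr_deriv ?_
    simp only [he, WithLp.ofLp_sub, mulVec_sub, Pi.add_apply, Pi.sub_apply, hs, hr]
    ring
  have hq := hasDerivAt_quadratic_moving
    (fun i j => (hasDerivWithinAt_entry hinv i j).hasDerivAt hnhds) hederiv
  refine ⟨_, (hq.add (HasDerivAt.fun_sum fun i _ => h2 i ht)).add
    (HasDerivAt.fun_sum fun i _ => h3 i ht), ?_⟩
  have hrr : r = D *ᵥ (d t).ofLp - C *ᵥ e := by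
    simp only [hr, innovation, he, WithLp.ofLp_sub, mulVec_sub]
    abel
  refine (lyapunov_deriv_le (hpos t ht) hw hgam1 hα1 hα2 (hS t ht) e (d t).ofLp (σ t) (ε t) r s
    (fun i => (h.bound_pos' hgam1 hgam2 ht i).le) (fun i => (h.tracker_pos' hgam2 ht i).le) hrr
    fun i => sat_mul_sub_nonpos (Real.sqrt_nonneg _) _).trans ?_
  have hΓ : (Dᵀ * diagonal gam2 * D).PosSemidef :=
    posSemidef_transpose_mul_mul (PosSemidef.diagonal fun i => (hgam2 i).le) D
  rw [norm_sq_eq_dotProduct]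
  have := quadratic_le_lamMax (hU.posSemidef.add hΓ).isHermitian (d t).ofLp
  simp only [lyapunov]
  linarith

end Trajectory

lemma tendsto_inv_of_posDef {P : ℝ → Matrix (Fin n) (Fin n) ℝ} {L : Matrix (Fin n) (Fin n) ℝ}
    (hL : L.PosDef) (h : Tendsto P atTop (𝓝 L)) : Tendsto (fun t => (P t)⁻¹) atTop (𝓝 L⁻¹) := by
  refine (continuousAt_matrix_inv L ?_).tendsto.comp h
  rw [Ring.inverse_eq_inv']
  exact continuousAt_inv₀ (det_isUnit_of_posDef hL).ne_zero

end SaturatedFilter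

/-! ### From decay of the Lyapunov function to bounds on the error -/

section ErrorBounds

lemma tendsto_exp_neg_mul_sub {α : ℝ} (hα : 0 < α) (T : ℝ) :
    Tendsto (fun t : ℝ => Real.exp (-α * (t - T))) atTop (𝓝 0) := by
  have h1 : Tendsto (fun t : ℝ => -α * (t - T)) atTop atBot :=
    (tendsto_atTop_add_const_right _ (-T) tendsto_id).const_mul_atTop_of_neg (neg_lt_zero.2 hα)
  exact Real.tendsto_exp_atBot.comp h1

variable {n m : ℕ} {V : ℝ → ℝ} {e : ℝ → EuclideanSpace ℝ (Fin n)}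
  {d : ℝ → EuclideanSpace ℝ (Fin m)} {α c μ : ℝ}

lemma exists_trace_le {P : ℝ → Matrix (Fin n) (Fin n) ℝ} {L : Matrix (Fin n) (Fin n) ℝ}
    (hP : ContinuousOn P (Ici 0)) (hL : Tendsto P atTop (𝓝 L)) :
    ∃ k, 0 ≤ k ∧ ∀ t, 0 ≤ t → trace (P t) ≤ k := by
  have htr : Tendsto (fun t => trace (P t)) atTop (𝓝 (trace L)) :=
    ((by fun_prop : Continuous fun M : Matrix (Fin n) (Fin n) ℝ => trace M).tendsto L).comp hL
  obtain ⟨T, hT⟩ := eventually_atTop.1 (htr.eventually_le_const (lt_add_one (trace L)))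
  have hc : ContinuousOn (fun t => trace (P t)) (Icc 0 T) :=
    (by fun_prop : ContinuousOn (fun t => trace (P t)) (Ici 0)).mono Icc_subset_Ici_self
  obtain ⟨K, hK⟩ := isCompact_Icc.bddAbove_image hc
  refine ⟨max 0 (max (trace L + 1) K), le_max_left _ _, fun t ht => le_max_of_le_right ?_⟩
  rcases le_total T t with h | h
  · exact le_max_of_le_left (hT t h)
  · exact le_max_of_le_right (hK (mem_image_of_mem _ ⟨ht, h⟩))

/-- The error bound implied by a bound on the Lyapunov function. -/
lemma norm_le_sqrt_of_quadratic_le {P : Matrix (Fin n) (Fin n) ℝ} (hP : P.PosDef)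
    {v : EuclideanSpace ℝ (Fin n)} {B : ℝ} (h : v.ofLp ⬝ᵥ P *ᵥ v.ofLp ≤ B) :
    ‖v‖ ≤ √(1 / lamMin P * B) := by
  rcases Nat.eq_zero_or_pos n with rfl | hn
  · rw [Subsingleton.elim v 0, norm_zero]
    exact Real.sqrt_nonneg _
  have : NeZero n := ⟨hn.ne'⟩
  have h1 := lamMin_mul_le_quadratic hP.isHermitian v.ofLp
  have h2 := lamMin_pos hP
  refine Real.le_sqrt_of_sq_le ?_
  rw [norm_sq_eq_dotProduct, one_div, ← div_eq_inv_mul, le_div_iff₀ h2]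
  linarith

/-- The asymptotic error bound, for weights that converge to a positive definite matrix. -/
lemma isBoundedUnder_and_limsup_le {N : ℝ → Matrix (Fin n) (Fin n) ℝ}
    {L : Matrix (Fin n) (Fin n) ℝ} (hL : L.PosDef) (hN : Tendsto N atTop (𝓝 L)) {B : ℝ → ℝ}
    {b : ℝ} (hB : Tendsto B atTop (𝓝 b))
    (h : ∀ᶠ t in atTop, (e t).ofLp ⬝ᵥ N t *ᵥ (e t).ofLp ≤ B t) :
    IsBoundedUnder (· ≤ ·) atTop (fun t => ‖e t‖) ∧
      limsup (fun t => ‖e t‖) atTop ≤ √(b / lamMin L) := by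
  -- For `n = 0` the spectrum is empty and `lamMin` is `0`, so positivity of `lamMin` fails; the
  -- error is zero.
  rcases Nat.eq_zero_or_pos n with rfl | hn
  · have h0 : (fun t => ‖e t‖) = fun _ => 0 := funext fun t => by
      rw [Subsingleton.elim (e t) 0, norm_zero]
    rw [h0]
    exact ⟨isBoundedUnder_const, by simp⟩
  have : NeZero n := ⟨hn.ne'⟩
  have hlam := lamMin_pos hL
  -- The Frobenius distance to the limit gives `N t ≥ lamMin L - η t` as forms, which replaces
  -- continuity of the smallest eigenvalue.
  set η : ℝ → ℝ := fun t => √(trace ((N t - L)ᵀ * (N t - L))) with hη_def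
  have hη : Tendsto η atTop (𝓝 0) := by
    have hc : Continuous fun M : Matrix (Fin n) (Fin n) ℝ => √(trace ((M - L)ᵀ * (M - L))) := by
      fun_prop
    simpa [η, Function.comp_def] using (hc.tendsto L).comp hN
  have hden : Tendsto (fun t => lamMin L - η t) atTop (𝓝 (lamMin L)) := by
    simpa using hη.const_sub (lamMin L)
  have hlim : Tendsto (fun t => √(B t / (lamMin L - η t))) atTop (𝓝 √(b / lamMin L)) :=
    (Real.continuous_sqrt.tendsto _).comp (hB.div hden hlam.ne')
  have hle : ∀ᶠ t in atTop, ‖e t‖ ≤ √(B t / (lamMin L - η t)) := by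
    filter_upwards [h, hden.eventually_const_lt hlam] with t ht hpos
    refine Real.le_sqrt_of_sq_le ?_
    rw [le_div_iff₀ hpos, norm_sq_eq_dotProduct]
    have h1 := lamMin_mul_le_quadratic hL.isHermitian (e t).ofLp
    have h2 := (abs_le.1 (abs_quadratic_le (N t - L) (e t).ofLp)).1
    rw [sub_mulVec, dotProduct_sub] at h2
    simp only [hη_def]
    linarith
  refine ⟨hlim.isBoundedUnder_le.mono_le hle, ?_⟩
  rw [← hlim.limsup_eq]
  refine limsup_le_limsup hle ?_ hlim.isBoundedUnder_le
  exact (isBoundedUnder_of ⟨0, fun t => norm_nonneg _⟩ :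
    IsBoundedUnder (· ≥ ·) atTop fun t => ‖e t‖).isCoboundedUnder_le

/-- Grönwall's inequality is restarted at a time after which `‖d‖ ≤ δ`; then `δ` tends to `0`. The
summand `δ` in `key` only makes the inequality strict. -/
lemma tendsto_zero_of_dissipation {k : ℝ} (hα : 0 < α)
    (hV : ∀ T, 0 ≤ T → ∀ δ, (∀ t, T ≤ t → ‖d t‖ ≤ δ) → ∀ t, T ≤ t →
      V t ≤ Real.exp (-α * (t - T)) * V T
        + 1 / α * (1 - Real.exp (-α * (t - T))) * (c * δ ^ 2))
    (he : ∀ t, 0 ≤ t → ‖e t‖ ^ 2 ≤ k * V t) (hk : 0 ≤ k) (hd : Tendsto d atTop (𝓝 0)) :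
    Tendsto e atTop (𝓝 0) := by
  have key (δ : ℝ) (hδ : 0 < δ) :
      ∀ᶠ t in atTop, ‖e t‖ ^ 2 < k * (1 / α * (c * δ ^ 2)) + δ := by
    have hdn : Tendsto (fun t => ‖d t‖) atTop (𝓝 0) := by simpa using hd.norm
    obtain ⟨T₀, hT₀⟩ := eventually_atTop.1 (hdn.eventually_le_const hδ)
    set T := max T₀ 0
    have hT : ∀ t, T ≤ t → ‖d t‖ ≤ δ := fun t ht => hT₀ t ((le_max_left _ _).trans ht)
    have hE := tendsto_exp_neg_mul_sub hα T
    have hlim : Tendsto (fun t => k * (Real.exp (-α * (t - T)) * V T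
        + 1 / α * (1 - Real.exp (-α * (t - T))) * (c * δ ^ 2))) atTop
        (𝓝 (k * (0 * V T + 1 / α * (1 - 0) * (c * δ ^ 2)))) :=
      ((hE.mul_const _).add (((hE.const_sub 1).const_mul _).mul_const _)).const_mul k
    have hlt : k * (0 * V T + 1 / α * (1 - 0) * (c * δ ^ 2))
        < k * (1 / α * (c * δ ^ 2)) + δ := by
      rw [zero_mul, zero_add, sub_zero, mul_one]
      linarith
    filter_upwards [hlim.eventually_lt_const hlt, eventually_ge_atTop T] with t h1 h2
    exact ((he t ((le_max_right _ _).trans h2)).trans (mul_le_mul_of_nonneg_left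
      (hV T (le_max_right _ _) δ hT t h2) hk)).trans_lt h1
  have hsq : Tendsto (fun t => ‖e t‖ ^ 2) atTop (𝓝 0) := by
    refine tendsto_order.2 ⟨fun a ha => Eventually.of_forall fun t => ha.trans_le (sq_nonneg _),
      fun a ha => ?_⟩
    have hcont : Continuous fun δ : ℝ => k * (1 / α * (c * δ ^ 2)) + δ := by fun_prop
    have h0 : ∀ᶠ δ : ℝ in 𝓝[>] 0, k * (1 / α * (c * δ ^ 2)) + δ < a :=
      (hcont.tendsto 0).mono_left nhdsWithin_le_nhds |>.eventually_lt_const (by simpa using ha)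
    obtain ⟨δ, hδ, hpos⟩ := (h0.and self_mem_nhdsWithin).exists
    exact (key δ hpos).mono fun t ht => ht.trans hδ
  have hs := (Real.continuous_sqrt.tendsto 0).comp hsq
  rw [tendsto_zero_iff_norm_tendsto_zero]
  simpa [Function.comp_def] using hs

lemma exists_exp_bound_of_dissipation {k : ℝ} (hα : 0 < α) (hc : 0 ≤ c)
    (hV : ∀ T, 0 ≤ T → ∀ δ, (∀ t, T ≤ t → ‖d t‖ ≤ δ) → ∀ t, T ≤ t →
      V t ≤ Real.exp (-α * (t - T)) * V T
        + 1 / α * (1 - Real.exp (-α * (t - T))) * (c * δ ^ 2))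
    (hV0 : ∀ t, 0 ≤ t → 0 ≤ V t) (hμ : ∀ t, 0 ≤ t → ‖d t‖ ≤ μ)
    (he : ∀ t, 0 ≤ t → ‖e t‖ ^ 2 ≤ k * V t) (hk : 0 ≤ k) (hd : ∀ᶠ t in atTop, d t = 0) :
    ∃ κ : ℝ, ∀ t, 0 ≤ t → ‖e t‖ ≤ κ * Real.exp (-(α / 2) * t) := by
  obtain ⟨T₀, hT₀⟩ := eventually_atTop.1 hd
  set T := max T₀ 0
  have hT0 : 0 ≤ T := le_max_right _ _
  have hT : ∀ t, T ≤ t → ‖d t‖ ≤ 0 := fun t ht => by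
    rw [hT₀ t ((le_max_left _ _).trans ht), norm_zero]
  set b := 1 / α * (c * μ ^ 2)
  have hb : 0 ≤ b := by positivity
  -- `B` dominates `V T`, for times after `T`, and also `V 0 + b`, which bounds `V` on `[0, T]`,
  -- where `exp (-α (t - T)) ≥ 1`.
  set B := V T + V 0 + b
  have hVT := hV0 T hT0
  have hVz := hV0 0 le_rfl
  have hbound (t : ℝ) (ht : 0 ≤ t) : V t ≤ Real.exp (-α * (t - T)) * B := by
    rcases le_total T t with h | h
    · have h1 := hV T hT0 0 hT t h
      simp only [ne_eq, OfNat.ofNat_ne_zero, not_false_eq_true, zero_pow, mul_zero, add_zero] at h1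
      exact h1.trans (mul_le_mul_of_nonneg_left (by linarith) (Real.exp_pos _).le)
    · have h1 := hV 0 le_rfl μ hμ t ht
      have h2 : Real.exp (-α * (t - 0)) ≤ 1 := Real.exp_le_one_iff.2 (by nlinarith)
      have h3 := Real.exp_pos (-α * (t - 0))
      have h4 : 1 ≤ Real.exp (-α * (t - T)) := Real.one_le_exp (by nlinarith)
      have h5 : 1 / α * (1 - Real.exp (-α * (t - 0))) * (c * μ ^ 2)
          = (1 - Real.exp (-α * (t - 0))) * b := by ring
      rw [h5] at h1
      have h6 : V t ≤ B := by nlinarith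
      exact h6.trans (le_mul_of_one_le_left (by linarith) h4)
  refine ⟨√(k * (Real.exp (α * T) * B)), fun t ht => ?_⟩
  have hsplit : Real.exp (-α * (t - T)) = Real.exp (α * T) * Real.exp (-(α / 2) * t) ^ 2 := by
    rw [← Real.exp_nat_mul, ← Real.exp_add]
    push_cast
    ring_nf
  calc ‖e t‖ ≤ √(k * (Real.exp (α * T) * B) * Real.exp (-(α / 2) * t) ^ 2) := by
        refine Real.le_sqrt_of_sq_le (((he t ht).trans
          (mul_le_mul_of_nonneg_left (hbound t ht) hk)).trans_eq ?_)
        rw [hsplit]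
        ring
    _ = _ := by rw [Real.sqrt_mul' _ (sq_nonneg _), Real.sqrt_sq (Real.exp_pos _).le]

end ErrorBounds

end ISKF

end

theorem corollary1 {n p m : ℕ}
    (A : Matrix (Fin n) (Fin n) ℝ) (C : Matrix (Fin p) (Fin n) ℝ) (D : Matrix (Fin p) (Fin m) ℝ)
    (Q Qsqrt : Matrix (Fin n) (Fin n) ℝ) (R : Matrix (Fin p) (Fin p) ℝ)
    (hQ : Q.PosSemidef) (hR : R.PosDef)
    -- `Qsqrt` is the positive semidefinite square root of `Q`
    (hQsqrt : Qsqrt.PosSemidef) (hQsqrt_sq : Qsqrt * Qsqrt = Q)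
    (hstab : ISKF.Stabilizable A Qsqrt) (hdet : ISKF.Detectable A C)
    (lam1 lam2 gam1 gam2 : Fin p → ℝ)
    (hlam1 : ∀ i, lam1 i < 0) (hlam2 : ∀ i, lam2 i < 0)
    (hgam1 : ∀ i, 0 < gam1 i) (hgam2 : ∀ i, 0 < gam2 i)
    (d : ℝ → EuclideanSpace ℝ (Fin m)) (μ : ℝ) (hμ : 0 < μ) (hd : ∀ t, 0 ≤ t → ‖d t‖ ≤ μ)
    (P : ℝ → Matrix (Fin n) (Fin n) ℝ) (hP0 : (P 0).PosDef)
    (hP : ISKF.IsRiccatiSolution A C Q R P)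
    (x xhat : ℝ → EuclideanSpace ℝ (Fin n)) (σ ε : ℝ → Fin p → ℝ)
    (htraj : ISKF.IsTrajectory A C D R lam1 lam2 gam1 gam2 d P x xhat σ ε)
    (w : Fin p → ℝ) (hw : ∀ i, 0 < w i) (U : Matrix (Fin m) (Fin m) ℝ) (hU : U.PosDef)
    (α : ℝ) (hα : 0 < α)
    (hα1 : ∀ i, α ≤ -lam1 i) (hα2 : ∀ i, α ≤ -(lam2 i + gam1 i))
    (hS : ∀ t, 0 ≤ t → (ISKF.blockS C D Q R gam2 w U α (P t)).PosSemidef) :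
    let c₁ := ISKF.lamMax (U + Dᵀ * Matrix.diagonal gam2 * D)
    let V₀ := ISKF.lyapunov (P 0) (xhat 0 - x 0) (σ 0) (ε 0)
    -- the bound at every time
    (∀ t, 0 ≤ t → ‖xhat t - x t‖ ≤
      Real.sqrt (1 / ISKF.lamMin (P t)⁻¹ *
        (Real.exp (-α * t) * V₀ + 1 / α * (1 - Real.exp (-α * t)) * (c₁ * μ ^ 2)))) ∧
    -- the asymptotic bound, through the limit of `P`, the positive definite stationary solution
    (∃ Pinf : Matrix (Fin n) (Fin n) ℝ,
      Pinf.PosDef ∧ ISKF.riccati A C Q R Pinf = 0 ∧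
      (∀ P' : Matrix (Fin n) (Fin n) ℝ,
        P'.PosDef → ISKF.riccati A C Q R P' = 0 → P' = Pinf) ∧
      Tendsto P atTop (𝓝 Pinf) ∧
      -- In `ℝ` the `limsup` of a function unbounded above defaults to `0`; boundedness gives the
      -- next inequality its meaning.
      IsBoundedUnder (· ≤ ·) atTop (fun t => ‖xhat t - x t‖) ∧
      limsup (fun t => ‖xhat t - x t‖) atTop ≤
        Real.sqrt (c₁ / (α * ISKF.lamMin Pinf⁻¹)) * μ) ∧
    -- the error tends to zero if the outliers do
    (Tendsto d atTop (𝓝 0) → Tendsto (fun t => xhat t - x t) atTop (𝓝 0)) ∧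
    -- it does so exponentially if the outliers stop
    ((∀ᶠ t in atTop, d t = 0) →
      ∃ κ : ℝ, ∀ t, 0 ≤ t → ‖xhat t - x t‖ ≤ κ * Real.exp (-(α / 2) * t)) := by
  intro c₁ V₀
  set H := Cᵀ * R⁻¹ * C with hH_def
  set V : ℝ → ℝ := fun t => ISKF.lyapunov (P t) (xhat t - x t) (σ t) (ε t) with hV_def
  have hH : H.PosSemidef := ISKF.posSemidef_transpose_mul_mul hR.inv.posSemidef C
  have hQs := ISKF.transpose_eq_of_posSemidef hQ
  have hHs := ISKF.transpose_eq_of_posSemidef hH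
  have hpos (t : ℝ) (ht : 0 ≤ t) : (P t).PosDef := (hP.posDef_and_hasDerivWithinAt hQ hR hP0 ht).1
  have hder (t : ℝ) (ht : 0 ≤ t) : HasDerivWithinAt P (ISKF.riccatiField A Q H (P t)) (Ici 0) t :=
    (hP.posDef_and_hasDerivWithinAt hQ hR hP0 ht).2
  obtain ⟨L, hL, hL0, hlim, hLdom⟩ := ISKF.exists_tendsto_riccati hα hQs hHs hpos hder
    fun t ht => ISKF.dominates_of_blockS hQ hR (hpos t ht) hgam2 (hS t ht)
  have hc₁ : 0 ≤ c₁ := ISKF.lamMax_nonneg (hU.posSemidef.add (ISKF.posSemidef_transpose_mul_mul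
    (PosSemidef.diagonal fun i => (hgam2 i).le) D))
  have hae := htraj.ae_lyapunov_deriv_le hpos hder hgam1 hgam2 hw hU hα1 hα2 hS
  -- The free start `T` and level `δ` serve all the claims: `(0, μ)` for the bounds, small `δ` for
  -- `d → 0`, and `δ = 0` once the outliers stop.
  have hdiss (T : ℝ) (hT : 0 ≤ T) (δ : ℝ) (hδ : ∀ t, T ≤ t → ‖d t‖ ≤ δ) (t : ℝ) (ht : T ≤ t) :
      V t ≤ Real.exp (-α * (t - T)) * V T
        + 1 / α * (1 - Real.exp (-α * (t - T))) * (c₁ * δ ^ 2) := by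
    refine ISKF.le_of_ae_dissipation hα
      (fun T hT => htraj.absolutelyContinuous_lyapunov hpos hder hT) hT ?_ ht
    filter_upwards [hae] with s hs hTs
    obtain ⟨V', hV', hle⟩ := hs (hT.trans hTs)
    refine ⟨V', hV', hle.trans ?_⟩
    have h1 : ‖d s‖ ^ 2 ≤ δ ^ 2 := pow_le_pow_left₀ (norm_nonneg _) (hδ s hTs) 2
    have h2 := mul_le_mul_of_nonneg_left h1 hc₁
    linarith
  have hbound (t : ℝ) (ht : 0 ≤ t) :
      V t ≤ Real.exp (-α * t) * V₀ + 1 / α * (1 - Real.exp (-α * t)) * (c₁ * μ ^ 2) := by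
    simpa only [sub_zero] using hdiss 0 le_rfl μ hd t ht
  have hquad (t : ℝ) (ht : 0 ≤ t) :
      (xhat t - x t).ofLp ⬝ᵥ (P t)⁻¹ *ᵥ (xhat t - x t).ofLp ≤ V t := by
    have h1 : 0 ≤ ∑ i, σ t i :=
      Finset.sum_nonneg fun i _ => (htraj.bound_pos' hgam1 hgam2 ht i).le
    have h2 : 0 ≤ ∑ i, ε t i := Finset.sum_nonneg fun i _ => (htraj.tracker_pos' hgam2 ht i).le
    simp only [hV_def, ISKF.lyapunov]
    linarith
  have hVnonneg (t : ℝ) (ht : 0 ≤ t) : 0 ≤ V t :=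
    (ISKF.quadratic_nonneg (hpos t ht).inv.posSemidef _).trans (hquad t ht)
  obtain ⟨k, hk, htrace⟩ := ISKF.exists_trace_le
    (fun t ht => ISKF.continuousWithinAt_of_hasDerivWithinAt_matrix (hder t ht)) hlim
  -- `trace (P t)` bounds the inverse of the smallest eigenvalue of `(P t)⁻¹`, and it is bounded
  -- uniformly in time because `P` converges.
  have hnorm (t : ℝ) (ht : 0 ≤ t) : ‖xhat t - x t‖ ^ 2 ≤ k * V t := by
    have h1 := ISKF.dotProduct_self_le_trace_inv_mul (hpos t ht).inv (xhat t - x t).ofLp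
    rw [nonsing_inv_nonsing_inv _ (ISKF.det_isUnit_of_posDef (hpos t ht))] at h1
    rw [ISKF.norm_sq_eq_dotProduct]
    exact h1.trans (mul_le_mul (htrace t ht) (hquad t ht)
      (ISKF.quadratic_nonneg (hpos t ht).inv.posSemidef _) hk)
  refine ⟨fun t ht => ISKF.norm_le_sqrt_of_quadratic_le (hpos t ht).inv
    ((hquad t ht).trans (hbound t ht)), ⟨L, hL, ?_, ?_, hlim, ?_⟩, ?_, ?_⟩
  · rw [ISKF.riccati_eq_riccatiField hR (ISKF.transpose_eq_of_posSemidef hL.posSemidef), hL0]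
  · intro P' hP' hP'0
    rw [ISKF.riccati_eq_riccatiField hR (ISKF.transpose_eq_of_posSemidef hP'.posSemidef)] at hP'0
    exact ISKF.riccatiField_eq_zero_unique hα hQ hH hL hP' hL0 hP'0 hLdom
  · have hE : Tendsto (fun t => Real.exp (-α * t)) atTop (𝓝 0) := by
      simpa only [sub_zero] using ISKF.tendsto_exp_neg_mul_sub hα 0
    have hB : Tendsto (fun t => Real.exp (-α * t) * V₀
        + 1 / α * (1 - Real.exp (-α * t)) * (c₁ * μ ^ 2)) atTop
        (𝓝 (0 * V₀ + 1 / α * (1 - 0) * (c₁ * μ ^ 2))) :=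
      (hE.mul_const _).add (((hE.const_sub 1).const_mul _).mul_const _)
    have h := ISKF.isBoundedUnder_and_limsup_le (e := fun t => xhat t - x t) hL.inv
      (ISKF.tendsto_inv_of_posDef hL hlim) hB
      ((eventually_ge_atTop 0).mono fun t ht => (hquad t ht).trans (hbound t ht))
    refine ⟨h.1, h.2.trans_eq ?_⟩
    have hsplit : (0 * V₀ + 1 / α * (1 - 0) * (c₁ * μ ^ 2)) / ISKF.lamMin L⁻¹
        = c₁ / (α * ISKF.lamMin L⁻¹) * μ ^ 2 := by
      rw [zero_mul, zero_add, sub_zero, mul_one, div_mul_eq_div_div]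
      ring
    rw [hsplit, Real.sqrt_mul' _ (sq_nonneg _), Real.sqrt_sq hμ.le]
  · exact ISKF.tendsto_zero_of_dissipation hα hdiss hnorm hk
  · exact ISKF.exists_exp_bound_of_dissipation hα hc₁ hdiss hVnonneg hd hnorm hk
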